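/- \textbf{Setting.} Let $w:\mathbb R\to\mathbb R$ be bounded, non-negative, even and integrable with $\int w=1$, and regular: for some $0<W\le+\infty$, $w>0$ on $(-W,W)$ and $w=0$ off $[-W,W]$. Let $h_f,h_g:[0,1]\to[0,1]$ be non-decreasing with $h_f(0)=h_g(0)=0$, $h_f(1)=h_g(1)=1$, and let $h^{-1}(u)=\inf\{v\in[0,1]: h(v)\ge u\}$. Assume the strictly positive gap condition: $A(u)=\int_0^u (h_g^{-1}-h_f)\,du'$ satisfies $A(u)>0$ for $u\in(0,1)$ and $A(1)=0$. Put $\phi(u,v)=\int_0^u h_g^{-1}+\int_0^v h_f^{-1}-uv$ and call condition $(\Phi)$ the requirement that $\phi>0$ on $[0,1]^2$ except at $(0,0)$ and $(1,1)$, where $\phi=0$. Fix $\varepsilon>0$. A \emph{profile} is a non-decreasing $p:\mathbb R\to[0,1]$ with $|x|^{1+\varepsilon}p(x)\to0$ as $x\to-\infty$ and $|x|^{1+\varepsilon}(p(x)-1)\to0$ as $x\to+\infty$. Write $p^w=p*w$, $p^{-1}(u)=\inf\{x:p(x)\ge u\}$, and let $dp$ be the Lebesgue--Stieltjes measure of $p$.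 A pair of profiles $(f,g)$ is a \emph{fixed point} if $g(x)=h_g(f^w(x))$ and $f(x)=h_f(g^w(x))$ for all $x$. The potential is $$\mathcal W(f,g)=\int_{\mathbb R}\Big\{\int_0^{g(x)}h_g^{-1}(u)\,du+\int_0^{f(x)}h_f^{-1}(v)\,dv-f(x)g^w(x)\Big\}dx .$$ For profiles $p_0,p_1$ let $T_p(x)=p_1^{-1}(p_0(x+))$, and for $\lambda\in[0,1]$ let the displacement interpolant $p_\lambda$ be the cumulative distribution function with inverse $(1-\lambda)p_0^{-1}+\lambda p_1^{-1}$. \textbf{Claim.} \begin{enumerate} \item If $(f_0,g_0)$ and $(f_1,g_1)$ are fixed points, they are translates of each other: there is $c\in\mathbb R$ such that $y-T_f(y)=-c$ for $df_0$-a.e. $y$, $x-T_g(x)=-c$ for $dg_0$-a.e. $x$, and $f_1(x)=f_0(x-c)$, $g_1(x)=g_0(x-c)$ for all $x$. \end{enumerate} Suppose moreover that $\int|x|w(x)\,dx<\infty$. Then the integrand of $\mathcal W(f,g)$ is integrable for all pairs of profiles, and: \begin{enumerate} \setcounter{enumi}{1} \item (Strict displacement convexity.) Let $(f_0,g_0)$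 be a fixed point and $(f_1,g_1)$ any pair of profiles. If $g_1$ is not a.e. equal to a translate of $g_0$, or if $(\Phi)$ holds and $(f_1,g_1)$ is not a.e. equal to a common translate of $(f_0,g_0)$, then for all $\lambda\in(0,1)$ $$\mathcal W(f_\lambda,g_\lambda)<(1-\lambda)\mathcal W(f_0,g_0)+\lambda\,\mathcal W(f_1,g_1).$$ \item Every fixed point minimizes $\mathcal W$ over pairs of profiles. \item If $(f_0,g_0)$ and $(f_1,g_1)$ both minimize $\mathcal W$ over pairs of profiles, there is $c\in\mathbb R$ with $g_1=g_0(\cdot-c)$ a.e.; if $(\Phi)$ holds, also $f_1=f_0(\cdot-c)$ a.e. for the same $c$. \end{enumerate} -/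

import Mathlib

open MeasureTheory Set Filter Topology

noncomputable section

namespace CoupledScalar

/-- The standing assumptions on an averaging window: bounded, non-negative, even, integrable,
of total mass one. -/
structure IsWindow (w : ℝ → ℝ) : Prop where
  bounded : ∃ C : ℝ, ∀ x, w x ≤ C
  nonneg : ∀ x, 0 ≤ w x
  even : ∀ x, w (-x) = w x
  integrable : Integrable w
  integral_eq_one : ∫ x, w x = 1

/-- Regularity of a window: for some `0 < W ≤ +∞`, it is strictly positive on `]-W, W[` and
zero off `[-W, W]`. -/
def IsRegular (w : ℝ → ℝ) : Prop :=
  ∃ W : EReal, 0 < W ∧ (∀ x : ℝ, ((|x| : ℝ) : EReal) < W → 0 < w x) ∧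
    (∀ x : ℝ, W < ((|x| : ℝ) : EReal) → w x = 0)

/-- An update function: a non-decreasing map of `[0,1]` to itself with `h 0 = 0` and `h 1 = 1`
(only the values of `h` on `[0,1]` matter). -/
structure IsUpdate (h : ℝ → ℝ) : Prop where
  monotoneOn : MonotoneOn h (Icc 0 1)
  map_zero : h 0 = 0
  map_one : h 1 = 1

/-- The generalized inverse of an update function on `[0,1]`. -/
def genInv (h : ℝ → ℝ) (u : ℝ) : ℝ := sInf {v | v ∈ Icc (0 : ℝ) 1 ∧ u ≤ h v}

/-- The signed area `A(h_f, h_g; u)` between the two curves. -/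
def area (hf hg : ℝ → ℝ) (u : ℝ) : ℝ := ∫ t in (0 : ℝ)..u, (genInv hg t - hf t)

/-- The strictly positive gap condition, in terms of the signed area. -/
def StrictlyPositiveGap (hf hg : ℝ → ℝ) : Prop :=
  (∀ u ∈ Ioo (0 : ℝ) 1, 0 < area hf hg u) ∧ area hf hg 1 = 0

/-- The function `φ(h_f, h_g; u, v)`. -/
def phi (hf hg : ℝ → ℝ) (u v : ℝ) : ℝ :=
  (∫ t in (0 : ℝ)..u, genInv hg t) + (∫ t in (0 : ℝ)..v, genInv hf t) - u * v

/-- The two-variable form of the gap condition: `φ > 0` on `[0,1]²` except at `(0,0)` and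
`(1,1)`, where `φ = 0`. -/
def StrictlyPositiveGapPhi (hf hg : ℝ → ℝ) : Prop :=
  (∀ u ∈ Icc (0 : ℝ) 1, ∀ v ∈ Icc (0 : ℝ) 1,
      (u, v) ≠ ((0 : ℝ), (0 : ℝ)) → (u, v) ≠ ((1 : ℝ), (1 : ℝ)) → 0 < phi hf hg u v) ∧
    phi hf hg 0 0 = 0 ∧ phi hf hg 1 1 = 0

/-- The smoothed profile `p ⊗ w`. -/
def smooth (w p : ℝ → ℝ) : ℝ → ℝ :=
  MeasureTheory.convolution p w (ContinuousLinearMap.mul ℝ ℝ) volume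

/-- Profiles `ℝ → [0,1]` with `|x|^(1+ε) p(x) → 0` at `-∞` and `x^(1+ε) (p(x) - 1) → 0`
at `+∞`. -/
def ProfileSpace (ε : ℝ) : Set (ℝ → ℝ) :=
  {p | (∀ x, p x ∈ Icc (0 : ℝ) 1) ∧
    Tendsto (fun x => |x| ^ (1 + ε) * p x) atBot (𝓝 0) ∧
    Tendsto (fun x => |x| ^ (1 + ε) * (p x - 1)) atTop (𝓝 0)}

/-- Pairs of non-decreasing profiles in the profile space: the domain of the potential. -/
structure IsMonotonePair (ε : ℝ) (f g : ℝ → ℝ) : Prop where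
  mem_f : f ∈ ProfileSpace ε
  mem_g : g ∈ ProfileSpace ε
  mono_f : Monotone f
  mono_g : Monotone g

/-- Solutions of the coupled density evolution equations `g = h_g(f ⊗ w)`, `f = h_f(g ⊗ w)`. -/
structure IsFixedPoint (w hf hg f g : ℝ → ℝ) : Prop where
  eq_g : ∀ x, g x = hg (smooth w f x)
  eq_f : ∀ x, f x = hf (smooth w g x)

/-- The integrand `I_{f,g}(x) - f(x) (g ⊗ w)(x)` of the potential. -/
def potentialDensity (w hf hg f g : ℝ → ℝ) (x : ℝ) : ℝ :=
  ((∫ u in (0 : ℝ)..g x, genInv hg u) + ∫ v in (0 : ℝ)..f x, genInv hf v) - f x * smooth w g x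

/-- The potential functional of the pair of profiles `f`, `g`. -/
def potential (w hf hg f g : ℝ → ℝ) : ℝ := ∫ x, potentialDensity w hf hg f g x

/-- Minimizers of the potential among pairs of non-decreasing profiles. -/
def IsMinimizer (ε : ℝ) (w hf hg f g : ℝ → ℝ) : Prop :=
  IsMonotonePair ε f g ∧
    ∀ f' g' : ℝ → ℝ, IsMonotonePair ε f' g' → potential w hf hg f g ≤ potential w hf hg f' g'

/-- The generalized inverse of a profile, seen as a cumulative distribution function. -/
def quantile (p : ℝ → ℝ) (u : ℝ) : ℝ := sInf {x | u ≤ p x}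

/-- The map `T = p₁⁻¹ ∘ p₀`, where `p₀` is read as a cumulative distribution function, that is
through its right-continuous version. -/
def transportMap (p₀ p₁ : ℝ → ℝ) (x : ℝ) : ℝ := quantile p₁ (Function.rightLim p₀ x)

/-- The Lebesgue-Stieltjes measure `dp` of a non-decreasing profile. -/
def profileMeasure {p : ℝ → ℝ} (hp : Monotone p) : Measure ℝ := hp.stieltjesFunction.measure

/-- The displacement interpolant: the cumulative distribution function whose inverse is
`(1 - l) p₀⁻¹ + l p₁⁻¹`. See `dispInterp_interpolated_point` for the pointwise form. -/
def dispInterp (l : ℝ) (p₀ p₁ : ℝ → ℝ) (x : ℝ) : ℝ :=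
  volume.real {u | u ∈ Ioo (0 : ℝ) 1 ∧ (1 - l) * quantile p₀ u + l * quantile p₁ u ≤ x}

theorem quantile_mono {p : ℝ → ℝ} (hp : Monotone p) (h0 : Tendsto p atBot (𝓝 0))
    (h1 : Tendsto p atTop (𝓝 1)) {u v : ℝ} (hu : 0 < u) (hv : v < 1) (huv : u ≤ v) :
    quantile p u ≤ quantile p v := by
  apply csInf_le_csInf
  · obtain ⟨a, ha⟩ := (h0.eventually (gt_mem_nhds hu)).exists
    refine ⟨a, fun x hx => ?_⟩
    by_contra hlt
    exact absurd (hx.trans (hp (not_le.mp hlt).le)) (not_le.mpr ha)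
  · obtain ⟨b, hb⟩ := (h1.eventually (lt_mem_nhds hv)).exists
    exact ⟨b, hb.le⟩
  · exact fun x hx => huv.trans hx

/-- For a continuous strictly increasing `p₀`, the displacement interpolant takes the value
`p₀ x` at the interpolated point `(1 - l) x + l T(x)`. -/
theorem dispInterp_interpolated_point {p₀ p₁ : ℝ → ℝ} (hc : Continuous p₀) (hs : StrictMono p₀)
    (h00 : Tendsto p₀ atBot (𝓝 0)) (h01 : Tendsto p₀ atTop (𝓝 1)) (hp₁ : Monotone p₁)
    (h10 : Tendsto p₁ atBot (𝓝 0)) (h11 : Tendsto p₁ atTop (𝓝 1))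
    {l : ℝ} (hl0 : 0 ≤ l) (hl1 : l < 1) (x : ℝ) :
    dispInterp l p₀ p₁ ((1 - l) * x + l * transportMap p₀ p₁ x) = p₀ x := by
  have hpos : ∀ y, 0 < p₀ y := fun y =>
    lt_of_le_of_lt (hs.monotone.le_of_tendsto h00 (y - 1)) (hs (by linarith))
  have hlt : ∀ y, p₀ y < 1 := fun y =>
    lt_of_lt_of_le (hs (by linarith : y < y + 1)) (hs.monotone.ge_of_tendsto h01 (y + 1))
  have hq : ∀ y, quantile p₀ (p₀ y) = y := by
    intro y
    have : {z | p₀ y ≤ p₀ z} = Ici y := by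
      ext z
      exact hs.le_iff_le
    rw [quantile, this, csInf_Ici]
  have hsurj : ∀ u ∈ Ioo (0 : ℝ) 1, ∃ y, p₀ y = u := by
    intro u hu
    obtain ⟨a, ha⟩ := (h00.eventually (gt_mem_nhds hu.1)).exists
    obtain ⟨b, hb⟩ := (h01.eventually (lt_mem_nhds hu.2)).exists
    exact mem_range_of_exists_le_of_exists_ge hc ⟨a, ha.le⟩ ⟨b, hb.le⟩
  have hT : transportMap p₀ p₁ x = quantile p₁ (p₀ x) := by
    rw [transportMap, (hc.continuousAt.continuousWithinAt).rightLim_eq]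
  have hset : {u | u ∈ Ioo (0 : ℝ) 1 ∧ (1 - l) * quantile p₀ u + l * quantile p₁ u ≤
      (1 - l) * x + l * transportMap p₀ p₁ x} = Ioc 0 (p₀ x) := by
    ext u
    constructor
    · rintro ⟨hu, hle⟩
      refine ⟨hu.1, ?_⟩
      by_contra hcon
      obtain ⟨y, rfl⟩ := hsurj u hu
      rw [hq, hT] at hle
      have hxy : x < y := hs.lt_iff_lt.mp (not_le.mp hcon)
      have := quantile_mono hp₁ h10 h11 (hpos x) (hlt y) (hs hxy).le
      nlinarith
    · rintro ⟨hu0, hux⟩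
      have hu1 : u < 1 := lt_of_le_of_lt hux (hlt x)
      refine ⟨⟨hu0, hu1⟩, ?_⟩
      obtain ⟨y, rfl⟩ := hsurj u ⟨hu0, hu1⟩
      rw [hq, hT]
      have hxy : y ≤ x := hs.le_iff_le.mp hux
      have := quantile_mono hp₁ h10 h11 hu0 (hlt x) hux
      nlinarith
  rw [dispInterp, hset, Real.volume_real_Ioc_of_le (hpos x).le, sub_zero]

/-- `p₁` is almost everywhere equal to the translate of `p₀` by `c`. -/
def IsTranslateAE (c : ℝ) (p₀ p₁ : ℝ → ℝ) : Prop := ∀ᵐ x : ℝ, p₁ x = p₀ (x - c)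

end CoupledScalar

end

noncomputable section

namespace CoupledScalar

/-! Everything is read in quantile coordinates. Let `U`, `V` be independent and uniform on `(0,1)`,
`Y = g⁻¹(U)`, `X = f⁻¹(V)`, and let `Ω` (`windowCDF`) be the distribution function of an independent
variable `S` with density `w`. Since `smooth w p x` is the mean of `Ω(x - p⁻¹)` (`smooth_eq`), the
fixed point equations imply that `b(u,v) = Ω(g⁻¹(u) - f⁻¹(v))` has the marginals `h_g⁻¹(u)` and `1 -
h_f⁻¹(v)`, which do not depend on the fixed point.

Rigidity: put `d(u,v) = g⁻¹(u) - f⁻¹(v)`. For two fixed points the integral of `(b₁ - b₀)(d₁ - d₀)`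
vanishes, because `d₁ - d₀` splits into a function of `u` and one of `v`, and the marginals agree.
The integrand is non-negative since `Ω` is monotone, so `b₁ = b₀` a.e. A regular window makes `Ω`
injective where `0 < Ω < 1`; hence the displacement of `g` at `u` equals that of `f` at `v` whenever
`0 < b₀(u,v) < 1`. The gap condition supplies the links: if no `v` is linked to a whole
neighbourhood of `u₀`, then for some `v₀` the function `b₀` is `0` and `1` on two opposite
rectangles with corner `(u₀,v₀)`, and the marginals give `φ(u₀,v₀) = 0`. So the displacement of `g`
is locally constant, hence constant (`exists_displacement_of_ae`). For fixed points the equations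
carry the translation over to `f`; otherwise `(Φ)` allows the same argument with the roles
exchanged.

Potential: the layer-cake formula gives `W = E max(X, Y+S) - E[Y h_g⁻¹(U)] - E[X h_f⁻¹(V)]`
(`integrable_and_integral_potentialDensity`). The last two terms are linear along displacement; the
first is convex, because `t ↦ E max(t,S)` is convex with slope `Ω`. Equality in convexity forces `b₀
= b₁` a.e., and rigidity applies. The subgradient inequality together with the marginals shows that
fixed points minimize. Conversely, testing a minimizer against the truncated update of one component
gives the fixed point equations in quantile form (`IsMinimizer.isWeakFixedPoint`), and uniqueness
follows from rigidity. -/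

/-! ### Distribution functions and their quantiles -/

/-- Non-decreasing functions with limits `0` at `-∞` and `1` at `+∞`; no side-continuity is
required. -/
structure IsCDF (p : ℝ → ℝ) : Prop where
  mono : Monotone p
  bot : Tendsto p atBot (𝓝 0)
  top : Tendsto p atTop (𝓝 1)

namespace IsCDF

variable {p : ℝ → ℝ}

theorem nonneg (hp : IsCDF p) (x : ℝ) : 0 ≤ p x := hp.mono.le_of_tendsto hp.bot x

theorem le_one (hp : IsCDF p) (x : ℝ) : p x ≤ 1 := hp.mono.ge_of_tendsto hp.top x

theorem quantile_le (hp : IsCDF p) {u x : ℝ} (hu : 0 < u) (h : u ≤ p x) : quantile p u ≤ x := by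
  obtain ⟨a, ha⟩ := (hp.bot.eventually (gt_mem_nhds hu)).exists
  refine csInf_le ⟨a, fun y hy => ?_⟩ h
  by_contra hlt
  exact absurd (hy.trans (hp.mono (not_le.mp hlt).le)) (not_le.mpr ha)

theorem le_of_quantile_lt (hp : IsCDF p) {u x : ℝ} (hu : u < 1) (h : quantile p u < x) :
    u ≤ p x := by
  obtain ⟨b, hb⟩ := (hp.top.eventually (lt_mem_nhds hu)).exists
  obtain ⟨y, hy, hyx⟩ := exists_lt_of_csInf_lt (s := {x | u ≤ p x}) ⟨b, hb.le⟩ h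
  exact le_trans hy (hp.mono hyx.le)

theorem le_quantile (hp : IsCDF p) {u x : ℝ} (hu : u < 1) (h : p x < u) : x ≤ quantile p u := by
  by_contra hc
  exact absurd (hp.le_of_quantile_lt hu (not_le.mp hc)) (not_le.mpr h)

theorem lt_of_lt_quantile (hp : IsCDF p) {u x : ℝ} (hu : 0 < u) (h : x < quantile p u) :
    p x < u := by
  by_contra hc
  exact absurd (hp.quantile_le hu (not_lt.mp hc)) (not_le.mpr h)

theorem quantile_monotoneOn (hp : IsCDF p) : MonotoneOn (quantile p) (Ioo 0 1) :=
  fun _ hu _ hv huv => quantile_mono hp.mono hp.bot hp.top hu.1 hv.2 huv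

/-- Left-continuity of quantiles is what later upgrades almost-everywhere identities between levels
to every level in `(0,1)`. -/
theorem tendsto_quantile (hp : IsCDF p) {u : ℝ} (hu : u ∈ Ioo (0 : ℝ) 1) :
    Tendsto (quantile p) (𝓝[<] u) (𝓝 (quantile p u)) := by
  rw [tendsto_order]
  constructor
  · intro a ha
    obtain ⟨a', h1, h2⟩ := exists_between ha
    have hlt := hp.lt_of_lt_quantile hu.1 h2
    filter_upwards [Ioo_mem_nhdsLT hlt] with t ht
    exact h1.trans_le (hp.le_quantile (ht.2.trans hu.2) ht.1)
  · intro b hb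
    filter_upwards [Ioo_mem_nhdsLT hu.1] with t ht
    exact (hp.quantile_monotoneOn ⟨ht.1, ht.2.trans hu.2⟩ hu ht.2.le).trans_lt hb

/-- The Galois connection can fail only at a jump of `p`, as no side-continuity is assumed. Jumps
are countable, so it is available at almost every `x`, which is enough under integrals. -/
theorem quantile_le_iff (hp : IsCDF p) {u x : ℝ} (hu : u ∈ Ioo (0 : ℝ) 1)
    (hx : ContinuousAt p x) : quantile p u ≤ x ↔ u ≤ p x := by
  refine ⟨fun h => ?_, hp.quantile_le hu.1⟩
  have ht : Tendsto p (𝓝[>] x) (𝓝 (p x)) := hx.tendsto.mono_left nhdsWithin_le_nhds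
  refine ge_of_tendsto ht ?_
  filter_upwards [self_mem_nhdsWithin] with y hy
  exact hp.le_of_quantile_lt hu.2 (lt_of_le_of_lt h hy)

theorem ae_continuousAt (hp : IsCDF p) : ∀ᵐ x : ℝ, ContinuousAt p x := by
  rw [ae_iff]
  exact hp.mono.countable_not_continuousAt.measure_zero _

theorem aemeasurable_quantile (hp : IsCDF p) :
    AEMeasurable (quantile p) (volume.restrict (Ioo 0 1)) :=
  aemeasurable_restrict_of_monotoneOn measurableSet_Ioo hp.quantile_monotoneOn

end IsCDF

instance : IsProbabilityMeasure (volume.restrict (Ioo (0 : ℝ) 1)) :=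
  ⟨by simp⟩

theorem integral_indicator_Iic_unit {h : ℝ → ℝ} {a : ℝ} (ha : a ∈ Icc (0 : ℝ) 1) :
    ∫ u in Ioo (0 : ℝ) 1, (Iic a).indicator h u = ∫ u in (0 : ℝ)..a, h u := by
  rw [← integral_Ioc_eq_integral_Ioo, setIntegral_indicator measurableSet_Iic,
    intervalIntegral.integral_of_le ha.1, Ioc_inter_Iic, min_eq_right ha.2]

/-! ### Elementary steps -/

/-- The difference between the unit step at `z` and the unit step at `0`. -/
def step (z x : ℝ) : ℝ := (Ici z).indicator 1 x - (Ici (0 : ℝ)).indicator 1 x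

theorem step_eq (z : ℝ) : step z = fun x => (Ico z 0).indicator 1 x - (Ico 0 z).indicator 1 x := by
  funext x
  simp only [step, indicator, mem_Ici, mem_Ico, Pi.one_apply]
  grind

theorem abs_step (z : ℝ) :
    (fun x => |step z x|) = fun x => (Ico z 0).indicator 1 x + (Ico 0 z).indicator 1 x := by
  funext x
  simp only [step, indicator, mem_Ici, mem_Ico, Pi.one_apply]
  grind

theorem integrable_indicator_Ico (a b : ℝ) : Integrable ((Ico a b).indicator (1 : ℝ → ℝ)) :=
  (integrable_indicator_iff measurableSet_Ico).2 (integrableOn_const (by simp))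

theorem integral_indicator_Ico (a b : ℝ) : ∫ x, (Ico a b).indicator (1 : ℝ → ℝ) x = max (b - a) 0 := by
  rw [integral_indicator_one measurableSet_Ico, Real.volume_real_Ico]

theorem integrable_step (z : ℝ) : Integrable (step z) := by
  rw [step_eq]
  exact (integrable_indicator_Ico _ _).sub (integrable_indicator_Ico _ _)

theorem integral_step (z : ℝ) : ∫ x, step z x = -z := by
  rw [step_eq, integral_sub (integrable_indicator_Ico _ _) (integrable_indicator_Ico _ _),
    integral_indicator_Ico, integral_indicator_Ico]
  rcases le_total z 0 with h | h <;> simp [h]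

theorem integral_abs_step (z : ℝ) : ∫ x, |step z x| = |z| := by
  rw [abs_step, integral_add (integrable_indicator_Ico _ _) (integrable_indicator_Ico _ _),
    integral_indicator_Ico, integral_indicator_Ico]
  rcases le_total z 0 with h | h <;> simp [h, abs_of_nonneg, abs_of_nonpos]

theorem abs_step_le (z x : ℝ) : |step z x| ≤ 1 := by
  by_cases h1 : z ≤ x <;> by_cases h2 : 0 ≤ x <;> simp [step, indicator, h1, h2]

section LayerCake

variable {Ω : Type*} [MeasurableSpace Ω] {μ : Measure Ω}

theorem aestronglyMeasurable_step {Z : Ω → ℝ} (hZ : AEMeasurable Z μ) :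
    AEStronglyMeasurable (fun z : Ω × ℝ => step (Z z.1) z.2) (μ.prod volume) := by
  have h1 : NullMeasurableSet {z : Ω × ℝ | Z z.1 ≤ z.2} (μ.prod volume) :=
    nullMeasurableSet_le hZ.comp_fst measurable_snd.aemeasurable
  have h2 : MeasurableSet {z : Ω × ℝ | (0 : ℝ) ≤ z.2} :=
    measurableSet_le measurable_const measurable_snd
  exact ((aestronglyMeasurable_const (b := (1 : ℝ))).indicator₀ h1).sub
    ((aestronglyMeasurable_const (b := (1 : ℝ))).indicator h2)

/-- Subtracting the step at `0` is what makes integration over the whole line possible: the `L¹`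
norm in `x` at fixed `ω` is `|Z ω| |ρ ω|`. -/
theorem integrable_step_mul [IsFiniteMeasure μ] {Z ρ : Ω → ℝ} (hZ : Integrable Z μ) (hρ : AEStronglyMeasurable ρ μ)
    {C : ℝ} (hC : ∀ᵐ ω ∂μ, ‖ρ ω‖ ≤ C) :
    Integrable (fun z : Ω × ℝ => step (Z z.1) z.2 * ρ z.1) (μ.prod volume) := by
  have hm : AEStronglyMeasurable (fun z : Ω × ℝ => step (Z z.1) z.2 * ρ z.1) (μ.prod volume) :=
    (aestronglyMeasurable_step hZ.aemeasurable).mul hρ.comp_fst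
  rw [integrable_prod_iff hm]
  refine ⟨Eventually.of_forall fun ω => ?_, ?_⟩
  · exact Integrable.mul_const (f := step (Z ω)) (integrable_step _) (ρ ω)
  have h : (fun ω => ∫ x, ‖step (Z ω) x * ρ ω‖) = fun ω => ‖Z ω‖ * ‖ρ ω‖ := by
    funext ω
    simp only [norm_mul]
    rw [integral_mul_const]
    simp only [Real.norm_eq_abs]
    rw [integral_abs_step]
  have hC' : ∀ᵐ ω ∂μ, ‖‖ρ ω‖‖ ≤ C := by
    filter_upwards [hC] with ω hω
    rwa [norm_norm]
  have hi : Integrable (fun ω => ‖Z ω‖ * ‖ρ ω‖) μ := hZ.norm.mul_bdd hρ.norm hC'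
  rw [← h] at hi
  exact hi

theorem integrable_integral_step_mul [IsFiniteMeasure μ] {Z ρ : Ω → ℝ} (hZ : Integrable Z μ)
    (hρ : AEStronglyMeasurable ρ μ) {C : ℝ} (hC : ∀ᵐ ω ∂μ, ‖ρ ω‖ ≤ C) :
    Integrable (fun x => ∫ ω, step (Z ω) x * ρ ω ∂μ) :=
  (integrable_step_mul hZ hρ hC).integral_prod_right

/-- Layer-cake formula for a signed random variable. -/
theorem integral_integral_step_mul [IsFiniteMeasure μ] {Z ρ : Ω → ℝ} (hZ : Integrable Z μ)
    (hρ : AEStronglyMeasurable ρ μ) {C : ℝ} (hC : ∀ᵐ ω ∂μ, ‖ρ ω‖ ≤ C) :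
    ∫ x, ∫ ω, step (Z ω) x * ρ ω ∂μ = -∫ ω, Z ω * ρ ω ∂μ := by
  rw [← integral_integral_swap (f := fun ω x => step (Z ω) x * ρ ω) (integrable_step_mul hZ hρ hC),
    ← integral_neg]
  congr 1
  funext ω
  rw [integral_mul_const, integral_step]
  ring

end LayerCake

/-! ### The distribution function of the window -/

/-- The distribution function of the probability density `w`. -/
def windowCDF (w : ℝ → ℝ) (t : ℝ) : ℝ := ∫ x in Iic t, w x

section Window

variable {w : ℝ → ℝ}

theorem windowCDF_sub (hw : IsWindow w) (a b : ℝ) :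
    windowCDF w b - windowCDF w a = ∫ x in a..b, w x :=
  intervalIntegral.integral_Iic_sub_Iic hw.integrable.integrableOn hw.integrable.integrableOn

theorem windowCDF_mono (hw : IsWindow w) : Monotone (windowCDF w) := by
  intro a b hab
  have h := windowCDF_sub hw a b
  have := intervalIntegral.integral_nonneg hab (f := w) (μ := volume) fun x _ => hw.nonneg x
  linarith

theorem windowCDF_neg (hw : IsWindow w) (t : ℝ) : windowCDF w (-t) = 1 - windowCDF w t := by
  have h1 : ∫ x in Iic (-t), w (-x) = ∫ x in Ioi t, w x := by
    simp
  have h2 := integral_add_compl (measurableSet_Iic (a := t)) hw.integrable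
  rw [compl_Iic, hw.integral_eq_one] at h2
  simp only [hw.even] at h1
  rw [windowCDF, windowCDF, h1]
  linarith

theorem windowCDF_nonneg (hw : IsWindow w) (t : ℝ) : 0 ≤ windowCDF w t :=
  integral_nonneg fun x => hw.nonneg x

theorem windowCDF_le_one (hw : IsWindow w) (t : ℝ) : windowCDF w t ≤ 1 := by
  have h1 := windowCDF_neg hw t
  have h2 := windowCDF_nonneg hw (-t)
  linarith

theorem windowCDF_continuous (hw : IsWindow w) : Continuous (windowCDF w) := by
  have h : windowCDF w = fun t => windowCDF w 0 + ∫ x in (0 : ℝ)..t, w x := by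
    funext t
    rw [← windowCDF_sub hw 0 t]
    ring
  rw [h]
  exact continuous_const.add (intervalIntegral.continuous_primitive
    (fun a b => hw.integrable.intervalIntegrable) 0)

theorem windowCDF_norm_le (hw : IsWindow w) (t : ℝ) : ‖windowCDF w t‖ ≤ 1 := by
  rw [Real.norm_eq_abs, abs_of_nonneg (windowCDF_nonneg hw t)]
  exact windowCDF_le_one hw t

theorem windowCDF_eq_zero {a : ℝ} (h : ∀ x < a, w x = 0) :
    windowCDF w a = 0 := by
  rw [windowCDF, integral_Iic_eq_integral_Iio]
  exact setIntegral_eq_zero_of_forall_eq_zero fun x hx => h x hx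

/-- A regular window has a distribution function that is injective at every point where it is
neither `0` nor `1`. -/
theorem eq_of_windowCDF_eq (hw : IsWindow w) (hreg : IsRegular w) {a b : ℝ}
    (h0 : 0 < windowCDF w a) (h1 : windowCDF w a < 1) (hab : windowCDF w a = windowCDF w b) :
    a = b := by
  obtain ⟨W, hW, hpos, hzero⟩ := hreg
  have hW0 : ∀ x : ℝ, W ≤ ((|x| : ℝ) : EReal) → ∀ y < -|x|, w y = 0 := by
    intro x hx y hy
    refine hzero y (lt_of_le_of_lt hx ?_)
    rw [EReal.coe_lt_coe_iff]
    have := neg_le_abs y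
    linarith
  -- At distance at least `W` from the origin all the mass of the window lies on one side, so the
  -- distribution function is `0` or `1` there.
  have hin : ((|a| : ℝ) : EReal) < W := by
    by_contra hc
    have hz := windowCDF_eq_zero (hW0 a (not_lt.mp hc))
    rcases abs_cases a with ⟨h, _⟩ | ⟨h, _⟩
    · rw [h, windowCDF_neg hw] at hz
      linarith
    · rw [h, neg_neg] at hz
      linarith
  have hopen : ∀ᶠ x in 𝓝 a, 0 < w x := by
    have hc : Continuous fun x : ℝ => ((|x| : ℝ) : EReal) :=
      continuous_coe_real_ereal.comp continuous_abs
    filter_upwards [hc.continuousAt.eventually_lt continuousAt_const hin] with x hx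
    exact hpos x hx
  obtain ⟨l, r, ha, hlr⟩ := mem_nhds_iff_exists_Ioo_subset.mp hopen
  have key : ∀ c d : ℝ, l ≤ c → c < d → d ≤ r → windowCDF w c < windowCDF w d := by
    intro c d hc hcd hd
    have : 0 < ∫ x in c..d, w x :=
      intervalIntegral.intervalIntegral_pos_of_pos_on hw.integrable.intervalIntegrable
        (fun x hx => hlr ⟨hc.trans_lt hx.1, hx.2.trans_le hd⟩) hcd
    rw [← windowCDF_sub hw] at this
    linarith
  -- The point `b` may lie outside the interval on which positivity of `w` is known, so the
  -- comparison is made at `b` cut off at its ends.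
  rcases lt_trichotomy a b with h | h | h
  · have h2 := key a (min b r) ha.1.le (lt_min h ha.2) (min_le_right _ _)
    have h3 := windowCDF_mono hw (min_le_left b r)
    linarith
  · exact h
  · have h2 := key (max b l) a (le_max_right _ _) (max_lt h ha.1) ha.2.le
    have h3 := windowCDF_mono hw (le_max_left b l)
    linarith

/-! ### Smoothed profiles -/

variable {p : ℝ → ℝ}

theorem IsCDF.integral_indicator_quantile_le (hp : IsCDF p) {x : ℝ} (hx : ContinuousAt p x)
    (h : ℝ → ℝ) :
    ∫ u in Ioo (0 : ℝ) 1, {u | quantile p u ≤ x}.indicator h u = ∫ u in (0 : ℝ)..p x, h u := by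
  rw [← integral_indicator_Iic_unit ⟨hp.nonneg x, hp.le_one x⟩]
  refine setIntegral_congr_fun measurableSet_Ioo fun u hu => ?_
  simp only [indicator, mem_ofPred_eq, mem_Iic, hp.quantile_le_iff hu hx]

/-- If `Q` has distribution function `p`, then `p ⊗ w` is the distribution function of `Q + S`;
Fubini lets one condition on `S` or on `Q`. -/
theorem smooth_eq (hw : IsWindow w) (hp : IsCDF p) (x : ℝ) :
    smooth w p x = ∫ u in Ioo (0 : ℝ) 1, windowCDF w (x - quantile p u) := by
  let F : ℝ × ℝ → ℝ := {z : ℝ × ℝ | quantile p z.2 ≤ x - z.1}.indicator 1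
  have hFm : AEStronglyMeasurable F (volume.prod (volume.restrict (Ioo (0 : ℝ) 1))) := by
    refine (aestronglyMeasurable_const (b := (1 : ℝ))).indicator₀ ?_
    exact nullMeasurableSet_le hp.aemeasurable_quantile.comp_snd
      (measurable_const.sub measurable_fst).aemeasurable
  have hF1 : ∀ z, ‖F z‖ ≤ 1 := fun z => by
    by_cases h : quantile p z.2 ≤ x - z.1 <;> simp [F, h]
  have hFi : Integrable (fun z => F z * w z.1)
      (volume.prod (volume.restrict (Ioo (0 : ℝ) 1))) :=
    (hw.integrable.comp_fst _).bdd_mul hFm (ae_of_all _ hF1)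
  rw [smooth, convolution_mul_swap]
  have h1 : ∀ᵐ t : ℝ, p (x - t) * w t = ∫ u in Ioo (0 : ℝ) 1, F (t, u) * w t := by
    have hq : ∀ᵐ t : ℝ, ContinuousAt p (x - t) :=
      (quasiMeasurePreserving_sub_left volume x).ae hp.ae_continuousAt
    filter_upwards [hq] with t ht
    rw [integral_mul_const]
    congr 1
    have := hp.integral_indicator_quantile_le ht 1
    simp only [Pi.one_apply, intervalIntegral.integral_const, sub_zero, smul_eq_mul, mul_one]
      at this
    exact this.symm
  rw [integral_congr_ae h1, integral_integral_swap (f := fun t u => F (t, u) * w t) hFi]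
  congr 1
  funext u
  rw [windowCDF, ← integral_indicator measurableSet_Iic]
  congr 1
  funext t
  by_cases h : t ≤ x - quantile p u
  · have h' : quantile p u ≤ x - t := by linarith
    simp [F, indicator, h, h']
  · have h' : ¬ quantile p u ≤ x - t := by
      intro h'
      exact h (by linarith)
    simp [F, indicator, h, h']

theorem integrable_windowCDF_comp (hw : IsWindow w) {Ω : Type*} [MeasurableSpace Ω]
    {μ : Measure Ω} [IsFiniteMeasure μ] {Z : Ω → ℝ} (hZ : AEMeasurable Z μ) :
    Integrable (fun ω => windowCDF w (Z ω)) μ :=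
  Integrable.of_bound ((windowCDF_continuous hw).comp_aestronglyMeasurable
    hZ.aestronglyMeasurable) 1 (ae_of_all _ fun _ => windowCDF_norm_le hw _)

theorem integrable_windowCDF_sub_quantile (hw : IsWindow w) (hp : IsCDF p) (x : ℝ) :
    Integrable (fun u => windowCDF w (x - quantile p u)) (volume.restrict (Ioo 0 1)) :=
  integrable_windowCDF_comp hw (hp.aemeasurable_quantile.const_sub x)

theorem smooth_continuous (hw : IsWindow w) (hp : IsCDF p) : Continuous (smooth w p) := by
  rw [funext (smooth_eq hw hp)]
  refine continuous_of_dominated (bound := fun _ => 1)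
    (fun x => (integrable_windowCDF_sub_quantile hw hp x).aestronglyMeasurable)
    (fun x => ae_of_all _ fun u => windowCDF_norm_le hw _) (integrable_const _)
    (ae_of_all _ fun u => (windowCDF_continuous hw).comp (continuous_id.sub continuous_const))

theorem smooth_mono (hw : IsWindow w) (hp : IsCDF p) : Monotone (smooth w p) := by
  intro x y hxy
  rw [smooth_eq hw hp, smooth_eq hw hp]
  exact integral_mono (integrable_windowCDF_sub_quantile hw hp x)
    (integrable_windowCDF_sub_quantile hw hp y) fun u => windowCDF_mono hw (by linarith)

theorem smooth_mem_Icc (hw : IsWindow w) (hp : IsCDF p) (x : ℝ) :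
    smooth w p x ∈ Icc (0 : ℝ) 1 := by
  rw [smooth_eq hw hp]
  refine ⟨integral_nonneg fun u => windowCDF_nonneg hw _, ?_⟩
  calc _ ≤ ∫ _u in Ioo (0 : ℝ) 1, (1 : ℝ) :=
        integral_mono (integrable_windowCDF_sub_quantile hw hp x) (integrable_const _)
          fun u => windowCDF_le_one hw _
    _ = 1 := by simp

theorem smooth_comp_sub (p : ℝ → ℝ) (c x : ℝ) :
    smooth w (fun y => p (y - c)) x = smooth w p (x - c) := by
  rw [smooth, smooth, convolution_mul_swap, convolution_mul_swap]
  congr 1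
  funext t
  rw [sub_right_comm]

end Window

/-! ### Integrability of quantiles of profiles -/

theorem isBigO_rpow_of_tendsto {l : Filter ℝ} {ε : ℝ} {r : ℝ → ℝ} (hl : ∀ᶠ x in l, 1 < |x|)
    (h : Tendsto (fun x => |x| ^ (1 + ε) * r x) l (𝓝 0)) :
    r =O[l] fun x => |x| ^ (-(1 + ε)) := by
  refine Asymptotics.IsBigO.of_bound 1 ?_
  have h1 : ∀ᶠ x in l, |(|x| ^ (1 + ε) * r x)| < 1 := by
    have := h.abs
    rw [abs_zero] at this
    exact this.eventually (gt_mem_nhds one_pos)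
  filter_upwards [h1, hl] with x hx hx1
  have hpos : 0 < |x| ^ (1 + ε) := Real.rpow_pos_of_pos (by linarith) _
  rw [abs_mul, abs_of_pos hpos] at hx
  rw [Real.rpow_neg (abs_nonneg x), one_mul, norm_inv, Real.norm_eq_abs, Real.norm_eq_abs,
    abs_of_pos hpos, ← one_div, le_div_iff₀ hpos, mul_comm]
  exact hx.le

theorem tendsto_zero_of_isBigO_rpow {l : Filter ℝ} {ε : ℝ} (hε : 0 < ε) {r : ℝ → ℝ}
    (hl : Tendsto (fun x : ℝ => |x|) l atTop) (h : r =O[l] fun x => |x| ^ (-(1 + ε))) :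
    Tendsto r l (𝓝 0) :=
  h.trans_tendsto ((tendsto_rpow_neg_atTop (by linarith)).comp hl)

theorem isCDF_of_mem_profileSpace {ε : ℝ} (hε : 0 < ε) {p : ℝ → ℝ} (hp : p ∈ ProfileSpace ε)
    (hm : Monotone p) : IsCDF p := by
  refine ⟨hm, tendsto_zero_of_isBigO_rpow hε tendsto_abs_atBot_atTop
    (isBigO_rpow_of_tendsto (tendsto_abs_atBot_atTop.eventually_gt_atTop 1) hp.2.1), ?_⟩
  have := tendsto_zero_of_isBigO_rpow hε tendsto_abs_atTop_atTop
    (isBigO_rpow_of_tendsto (tendsto_abs_atTop_atTop.eventually_gt_atTop 1) hp.2.2)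
  simpa using this.add_const 1

/-- The decay rate `|x|^(-(1+ε))` of the profile space enters the argument here: it is integrable at
both ends. -/
theorem integrable_sub_heaviside {ε : ℝ} (hε : 0 < ε) {p : ℝ → ℝ} (hp : p ∈ ProfileSpace ε)
    (hm : Monotone p) : Integrable (fun x => p x - (Ici (0 : ℝ)).indicator 1 x) := by
  have hH : Monotone fun x : ℝ => (Ici (0 : ℝ)).indicator (1 : ℝ → ℝ) x := by
    intro x y hxy
    simp only [indicator, mem_Ici, Pi.one_apply]
    grind
  have hright : IntegrableOn (fun x : ℝ => |x| ^ (-(1 + ε))) (Ioi 1) := by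
    refine (integrableOn_Ioi_rpow_of_lt (a := -(1 + ε)) (by linarith) one_pos).congr_fun
      (fun x hx => ?_) measurableSet_Ioi
    rw [abs_of_pos (one_pos.trans hx)]
  have hleft : IntegrableOn (fun x : ℝ => |x| ^ (-(1 + ε))) (Iio (-1)) := by
    rw [← integrable_indicator_iff measurableSet_Iio]
    refine ((integrable_indicator_iff measurableSet_Ioi).2 hright).comp_neg.congr
      (ae_of_all _ fun x => ?_)
    simp [indicator, lt_neg]
  have hloc : LocallyIntegrable (fun x => p x - (Ici (0 : ℝ)).indicator 1 x) volume :=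
    hm.locallyIntegrable.sub hH.locallyIntegrable
  have hbot : (fun x => p x - (Ici (0 : ℝ)).indicator 1 x) =O[atBot]
      fun x => |x| ^ (-(1 + ε)) := by
    refine (isBigO_rpow_of_tendsto (tendsto_abs_atBot_atTop.eventually_gt_atTop 1)
      hp.2.1).congr' ?_ EventuallyEq.rfl
    filter_upwards [eventually_lt_atBot (0 : ℝ)] with x hx
    simp [hx]
  have htop : (fun x => p x - (Ici (0 : ℝ)).indicator 1 x) =O[atTop]
      fun x => |x| ^ (-(1 + ε)) := by
    refine (isBigO_rpow_of_tendsto (tendsto_abs_atTop_atTop.eventually_gt_atTop 1)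
      hp.2.2).congr' ?_ EventuallyEq.rfl
    filter_upwards [eventually_ge_atTop (0 : ℝ)] with x hx
    simp [hx]
  exact hloc.integrable_of_isBigO_atBot_atTop hbot ⟨Iio (-1), Iio_mem_atBot _, hleft⟩ htop
    ⟨Ioi 1, Ioi_mem_atTop _, hright⟩

/-- Both sides are a double integral of `|step (quantile p u) x|`: integrating first in `u` gives
`|p x - 1_{x ≥ 0}|`, first in `x` gives `|quantile p u|`. -/
theorem IsCDF.integrable_quantile {p : ℝ → ℝ} (hp : IsCDF p)
    (hi : Integrable (fun x => p x - (Ici (0 : ℝ)).indicator 1 x)) :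
    Integrable (quantile p) (volume.restrict (Ioo 0 1)) := by
  let D : ℝ × ℝ → ℝ := fun z => step (quantile p z.1) z.2
  have hm : AEStronglyMeasurable D ((volume.restrict (Ioo (0 : ℝ) 1)).prod volume) :=
    aestronglyMeasurable_step hp.aemeasurable_quantile
  have hD : Integrable D ((volume.restrict (Ioo (0 : ℝ) 1)).prod volume) := by
    rw [integrable_prod_iff' hm]
    have hmeas : ∀ x : ℝ, AEMeasurable (fun u => D (u, x)) (volume.restrict (Ioo 0 1)) := by
      intro x
      have h1 : NullMeasurableSet {u | quantile p u ≤ x} (volume.restrict (Ioo (0 : ℝ) 1)) :=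
        nullMeasurableSet_le hp.aemeasurable_quantile aemeasurable_const
      exact (((aestronglyMeasurable_const (b := (1 : ℝ))).indicator₀ h1).sub
        (aestronglyMeasurable_const (b := (Ici (0 : ℝ)).indicator (1 : ℝ → ℝ) x))).aemeasurable
    refine ⟨ae_of_all _ fun x => Integrable.of_bound (hmeas x).aestronglyMeasurable 1
      (ae_of_all _ fun u => abs_step_le _ _), ?_⟩
    refine hi.norm.congr ?_
    filter_upwards [hp.ae_continuousAt] with x hx
    have key := hp.integral_indicator_quantile_le hx 1
    simp only [Pi.one_apply, intervalIntegral.integral_const, sub_zero, smul_eq_mul, mul_one]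
      at key
    rw [← key]
    by_cases h0 : 0 ≤ x
    · have h1 : ∀ u, ‖D (u, x)‖ = 1 - {u | quantile p u ≤ x}.indicator 1 u := by
        intro u
        by_cases h : quantile p u ≤ x <;> simp [D, step, indicator, h, h0]
      have h2 : Integrable ({u | quantile p u ≤ x}.indicator (1 : ℝ → ℝ))
          (volume.restrict (Ioo (0 : ℝ) 1)) := by
        refine Integrable.of_bound (((aestronglyMeasurable_const (b := (1 : ℝ)))).indicator₀
          (nullMeasurableSet_le hp.aemeasurable_quantile aemeasurable_const)) 1
          (ae_of_all _ fun u => ?_)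
        by_cases h : quantile p u ≤ x <;> simp [indicator, h]
      simp only [h1]
      rw [integral_sub (integrable_const _) h2, key]
      simp [h0, abs_sub_comm (p x), abs_of_nonneg (sub_nonneg.2 (hp.le_one x))]
    · have h1 : ∀ u, ‖D (u, x)‖ = {u | quantile p u ≤ x}.indicator 1 u := by
        intro u
        by_cases h : quantile p u ≤ x <;> simp [D, step, indicator, h, h0]
      simp only [h1]
      rw [key]
      simp [h0, abs_of_nonneg (hp.nonneg x)]
  have h2 := hD.integral_norm_prod_left
  simp only [D, Real.norm_eq_abs, integral_abs_step] at h2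
  exact (integrable_norm_iff hp.aemeasurable_quantile.aestronglyMeasurable).1 h2

theorem IsMonotonePair.isCDF_f {ε : ℝ} {f g : ℝ → ℝ} (h : IsMonotonePair ε f g) (hε : 0 < ε) :
    IsCDF f := isCDF_of_mem_profileSpace hε h.mem_f h.mono_f

theorem IsMonotonePair.isCDF_g {ε : ℝ} {f g : ℝ → ℝ} (h : IsMonotonePair ε f g) (hε : 0 < ε) :
    IsCDF g := isCDF_of_mem_profileSpace hε h.mem_g h.mono_g

theorem IsMonotonePair.integrable_quantile_f {ε : ℝ} {f g : ℝ → ℝ} (h : IsMonotonePair ε f g)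
    (hε : 0 < ε) : Integrable (quantile f) (volume.restrict (Ioo 0 1)) :=
  (h.isCDF_f hε).integrable_quantile (integrable_sub_heaviside hε h.mem_f h.mono_f)

theorem IsMonotonePair.integrable_quantile_g {ε : ℝ} {f g : ℝ → ℝ} (h : IsMonotonePair ε f g)
    (hε : 0 < ε) : Integrable (quantile g) (volume.restrict (Ioo 0 1)) :=
  (h.isCDF_g hε).integrable_quantile (integrable_sub_heaviside hε h.mem_g h.mono_g)

/-! ### Update functions and their generalized inverses -/

section Update

variable {h : ℝ → ℝ}

theorem IsUpdate.mem_Icc (hh : IsUpdate h) {v : ℝ} (hv : v ∈ Icc (0 : ℝ) 1) :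
    h v ∈ Icc (0 : ℝ) 1 := by
  have h0 := hh.monotoneOn (left_mem_Icc.2 zero_le_one) hv hv.1
  have h1 := hh.monotoneOn hv (right_mem_Icc.2 zero_le_one) hv.2
  rw [hh.map_zero] at h0
  rw [hh.map_one] at h1
  exact ⟨h0, h1⟩

theorem genInv_nonneg (h : ℝ → ℝ) (t : ℝ) : 0 ≤ genInv h t :=
  Real.sInf_nonneg fun _ hv => hv.1.1

theorem genInv_le {t v : ℝ} (hv : v ∈ Icc (0 : ℝ) 1) (ht : t ≤ h v) : genInv h t ≤ v :=
  csInf_le ⟨0, fun _ hx => hx.1.1⟩ ⟨hv, ht⟩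

theorem IsUpdate.genInv_le_one (hh : IsUpdate h) {t : ℝ} (ht : t ≤ 1) : genInv h t ≤ 1 :=
  genInv_le (right_mem_Icc.2 zero_le_one) (by rwa [hh.map_one])

theorem IsUpdate.le_of_genInv_lt (hh : IsUpdate h) {t v : ℝ} (ht : t ≤ 1) (hv : v ≤ 1)
    (hlt : genInv h t < v) : t ≤ h v := by
  have hne : {v | v ∈ Icc (0 : ℝ) 1 ∧ t ≤ h v}.Nonempty :=
    ⟨1, right_mem_Icc.2 zero_le_one, by rwa [hh.map_one]⟩
  obtain ⟨y, ⟨hy, hty⟩, hyv⟩ := exists_lt_of_csInf_lt hne hlt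
  exact hty.trans (hh.monotoneOn hy ⟨hy.1.trans hyv.le, hv⟩ hyv.le)

theorem IsUpdate.le_genInv (hh : IsUpdate h) {t v : ℝ} (ht : t ≤ 1) (hv : v ≤ 1)
    (hlt : h v < t) : v ≤ genInv h t := by
  by_contra hc
  exact absurd (hh.le_of_genInv_lt ht hv (not_le.mp hc)) (not_le.mpr hlt)

theorem IsUpdate.genInv_monotoneOn (hh : IsUpdate h) : MonotoneOn (genInv h) (Iic 1) := by
  intro s _ t ht hst
  refine csInf_le_csInf ⟨0, fun _ hx => hx.1.1⟩
    ⟨1, right_mem_Icc.2 zero_le_one, by rwa [hh.map_one]⟩ fun x hx => ⟨hx.1, hst.trans hx.2⟩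

theorem IsUpdate.genInv_intervalIntegrable (hh : IsUpdate h) {a b : ℝ} (ha : a ≤ 1)
    (hb : b ≤ 1) : IntervalIntegrable (genInv h) volume a b := by
  refine MonotoneOn.intervalIntegrable (hh.genInv_monotoneOn.mono fun x hx => ?_)
  rcases le_total a b with hab | hab
  · rw [uIcc_of_le hab] at hx
    exact hx.2.trans hb
  · rw [uIcc_of_ge hab] at hx
    exact hx.2.trans ha

theorem IsUpdate.intervalIntegrable (hh : IsUpdate h) {u : ℝ} (hu : u ∈ Icc (0 : ℝ) 1) :
    IntervalIntegrable h volume 0 u := by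
  refine MonotoneOn.intervalIntegrable (hh.monotoneOn.mono fun x hx => ?_)
  rw [uIcc_of_le hu.1] at hx
  exact ⟨hx.1, hx.2.trans hu.2⟩

theorem IsUpdate.aemeasurable_genInv (hh : IsUpdate h) :
    AEMeasurable (genInv h) (volume.restrict (Ioo 0 1)) :=
  aemeasurable_restrict_of_monotoneOn measurableSet_Ioo
    (hh.genInv_monotoneOn.mono fun _ hx => hx.2.le)

theorem IsUpdate.genInv_norm_le (hh : IsUpdate h) :
    ∀ᵐ t ∂(volume.restrict (Ioo (0 : ℝ) 1)), ‖genInv h t‖ ≤ 1 := by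
  refine (ae_restrict_mem measurableSet_Ioo).mono fun t ht => ?_
  rw [Real.norm_eq_abs, abs_of_nonneg (genInv_nonneg h t)]
  exact hh.genInv_le_one ht.2.le

/-- This is left-continuity of the generalized inverse, in the form needed for the first-order
condition of a minimizer. -/
theorem IsUpdate.genInv_le_of_forall_lt (hh : IsUpdate h) {v c : ℝ} (hv : v ∈ Ioc (0 : ℝ) 1)
    (hc : 0 ≤ c) (H : ∀ t ∈ Ioo 0 v, genInv h t ≤ c) : genInv h v ≤ c := by
  refine le_of_forall_gt_imp_ge_of_dense fun c' hc' => ?_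
  rcases le_total 1 c' with h1 | h1
  · exact (hh.genInv_le_one hv.2).trans h1
  · refine genInv_le ⟨hc.trans hc'.le, h1⟩ (le_of_forall_lt_imp_le_of_dense fun t ht => ?_)
    rcases le_or_gt t 0 with h0 | h0
    · exact h0.trans (hh.mem_Icc ⟨hc.trans hc'.le, h1⟩).1
    · exact hh.le_of_genInv_lt (ht.le.trans hv.2) h1 ((H t ⟨h0, ht⟩).trans_lt hc')

/-- The primitive of the generalized inverse, in terms of the update function itself. -/
theorem IsUpdate.integral_genInv (hh : IsUpdate h) {V : ℝ} (hV : V ∈ Icc (0 : ℝ) 1) :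
    ∫ t in (0 : ℝ)..V, genInv h t = ∫ v in Ioo (0 : ℝ) 1, max (V - h v) 0 := by
  have hm : AEMeasurable h (volume.restrict (Ioo 0 1)) :=
    aemeasurable_restrict_of_monotoneOn measurableSet_Ioo
      (hh.monotoneOn.mono Ioo_subset_Icc_self)
  let D : ℝ × ℝ → ℝ := {z : ℝ × ℝ | h z.2 < z.1}.indicator 1
  have hD : Integrable D ((volume.restrict (Ioc 0 V)).prod (volume.restrict (Ioo (0 : ℝ) 1))) := by
    refine Integrable.of_bound ((aestronglyMeasurable_const (b := (1 : ℝ))).indicator₀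
      (nullMeasurableSet_lt hm.comp_snd measurable_fst.aemeasurable)) 1 (ae_of_all _ fun z => ?_)
    by_cases hz : h z.2 < z.1 <;> simp [D, hz]
  -- The number `genInv h t` is the length of `{v | h v < t}`, up to the endpoint; Fubini then does
  -- the rest.
  have h1 : ∀ t ∈ Ioc 0 V, genInv h t = ∫ v in Ioo (0 : ℝ) 1, D (t, v) := by
    intro t ht
    have ht1 : t ≤ 1 := ht.2.trans hV.2
    have key := integral_indicator_Iic_unit (h := 1) (a := genInv h t)
      ⟨genInv_nonneg h t, hh.genInv_le_one ht1⟩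
    simp only [Pi.one_apply, intervalIntegral.integral_const, sub_zero, smul_eq_mul, mul_one]
      at key
    rw [← key]
    have hne : ∀ᵐ v ∂(volume.restrict (Ioo (0 : ℝ) 1)), v ≠ genInv h t :=
      Measure.ae_ne _ _
    refine integral_congr_ae ?_
    filter_upwards [hne, ae_restrict_mem measurableSet_Ioo] with v hv hv1
    have hiff : v ≤ genInv h t ↔ h v < t := by
      refine ⟨fun hle => ?_, hh.le_genInv ht1 hv1.2.le⟩
      by_contra hc
      exact hv (le_antisymm hle (genInv_le ⟨hv1.1.le, hv1.2.le⟩ (not_lt.mp hc)))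
    simp only [D, indicator, mem_Iic, mem_ofPred_eq, hiff, Pi.one_apply]
  rw [intervalIntegral.integral_of_le hV.1, setIntegral_congr_fun measurableSet_Ioc h1,
    integral_integral_swap (f := fun t v => D (t, v)) hD]
  refine setIntegral_congr_fun measurableSet_Ioo fun v hv => ?_
  have h2 : ∀ t, D (t, v) = (Ioi (h v)).indicator 1 t := fun t => rfl
  simp only [h2]
  rw [setIntegral_indicator measurableSet_Ioi, Ioc_inter_Ioi,
    max_eq_right (hh.mem_Icc ⟨hv.1.le, hv.2.le⟩).1]
  simp

theorem IsUpdate.integrable_sub (hh : IsUpdate h) (V : ℝ) :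
    Integrable (fun v => V - h v) (volume.restrict (Ioo 0 1)) := by
  have h1 := (hh.intervalIntegrable (right_mem_Icc.2 zero_le_one)).1
  exact (integrable_const V).sub (IntegrableOn.mono_set h1 Ioo_subset_Ioc_self)

theorem IsUpdate.integral_genInv_one (hh : IsUpdate h) :
    ∫ t in (0 : ℝ)..1, genInv h t = 1 - ∫ v in (0 : ℝ)..1, h v := by
  rw [hh.integral_genInv (right_mem_Icc.2 zero_le_one)]
  have : ∀ v ∈ Ioo (0 : ℝ) 1, max (1 - h v) 0 = 1 - h v := fun v hv =>
    max_eq_left (sub_nonneg.2 (hh.mem_Icc ⟨hv.1.le, hv.2.le⟩).2)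
  rw [setIntegral_congr_fun measurableSet_Ioo this, ← integral_Ioc_eq_integral_Ioo,
    ← intervalIntegral.integral_of_le zero_le_one,
    intervalIntegral.integral_sub (by simp)
      (hh.intervalIntegrable (right_mem_Icc.2 zero_le_one))]
  simp

/-- Young's inequality. -/
theorem IsUpdate.young (hh : IsUpdate h) {u v : ℝ} (hu : u ∈ Icc (0 : ℝ) 1)
    (hv : v ∈ Icc (0 : ℝ) 1) :
    u * v ≤ (∫ t in (0 : ℝ)..u, h t) + ∫ t in (0 : ℝ)..v, genInv h t := by
  have h1 : ∫ t in (0 : ℝ)..u, (v - h t) = u * v - ∫ t in (0 : ℝ)..u, h t := by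
    rw [intervalIntegral.integral_sub (by simp) (hh.intervalIntegrable hu)]
    simp
  -- Cutting a function off at a level set by hand never gives more than keeping exactly its
  -- positive part.
  have h2 : ∫ t in (0 : ℝ)..u, (v - h t) ≤ ∫ t in Ioo (0 : ℝ) 1, max (v - h t) 0 := by
    rw [← integral_indicator_Iic_unit hu]
    refine integral_mono ((hh.integrable_sub v).indicator measurableSet_Iic)
      (hh.integrable_sub v).pos_part fun t => ?_
    exact indicator_le' (fun _ _ => le_max_left _ _) (fun _ _ => le_max_right _ _) t
  rw [hh.integral_genInv hv]
  linarith

/-- The truncation to `[a, b]` of `h γ` minimizes `v ↦ ∫₀ᵛ h⁻¹ - v γ` over `[a, b]`. -/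
theorem IsUpdate.clamp_isMinOn (hh : IsUpdate h) {γ a b v : ℝ} (hγ : γ ∈ Icc (0 : ℝ) 1)
    (hb : b ≤ 1) (hv : v ∈ Icc a b) :
    (∫ t in (0 : ℝ)..max a (min b (h γ)), genInv h t) - max a (min b (h γ)) * γ ≤
      (∫ t in (0 : ℝ)..v, genInv h t) - v * γ := by
  set c := max a (min b (h γ)) with hc
  have hab : a ≤ b := hv.1.trans hv.2
  have hc1 : c ≤ 1 := max_le (hab.trans hb) ((min_le_left _ _).trans hb)
  have hv1 : v ≤ 1 := hv.2.trans hb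
  have hsplit : (∫ t in (0 : ℝ)..v, genInv h t) - ∫ t in (0 : ℝ)..c, genInv h t =
      ∫ t in c..v, genInv h t :=
    intervalIntegral.integral_interval_sub_left
      (hh.genInv_intervalIntegrable zero_le_one hv1) (hh.genInv_intervalIntegrable zero_le_one hc1)
  have hconst : ∀ x y : ℝ, ∫ _t in x..y, γ = (y - x) * γ := fun x y => by simp
  rcases lt_trichotomy v c with hlt | heq | hlt
  · have hle : c ≤ h γ := by
      rcases le_total a (min b (h γ)) with h1 | h1
      · rw [hc, max_eq_right h1]
        exact min_le_right _ _
      · rw [hc, max_eq_left h1] at hlt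
        exact absurd hv.1 (not_le.mpr hlt)
    have h2 : ∫ t in v..c, genInv h t ≤ ∫ _t in v..c, γ :=
      intervalIntegral.integral_mono_on hlt.le (hh.genInv_intervalIntegrable hv1 hc1) (by simp)
        fun t ht => genInv_le hγ (ht.2.trans hle)
    rw [hconst] at h2
    rw [intervalIntegral.integral_symm v c] at hsplit
    linarith
  · rw [heq]
  · have hle : h γ ≤ c := by
      rcases le_total b (h γ) with h1 | h1
      · rw [hc, min_eq_left h1, max_eq_right hab] at hlt
        exact absurd hv.2 (not_le.mpr hlt)
      · rw [hc, min_eq_right h1]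
        exact le_max_right _ _
    have h2 : ∫ _t in c..v, γ ≤ ∫ t in c..v, genInv h t := by
      refine intervalIntegral.integral_mono_on_of_le_Ioo hlt.le (by simp)
        (hh.genInv_intervalIntegrable hc1 hv1) fun t ht => ?_
      exact hh.le_genInv (ht.2.le.trans hv1) hγ.2 (hle.trans_lt ht.1)
    rw [hconst] at h2
    linarith

end Update

/-! ### Gap conditions, the area and the function `φ`. -/

section Gap

variable {hf hg : ℝ → ℝ}

theorem area_eq (hhf : IsUpdate hf) (hhg : IsUpdate hg) {u : ℝ} (hu : u ∈ Icc (0 : ℝ) 1) :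
    area hf hg u = (∫ t in (0 : ℝ)..u, genInv hg t) - ∫ t in (0 : ℝ)..u, hf t :=
  intervalIntegral.integral_sub (hhg.genInv_intervalIntegrable zero_le_one hu.2)
    (hhf.intervalIntegrable hu)

theorem area_le_phi (hhf : IsUpdate hf) (hhg : IsUpdate hg) {u v : ℝ} (hu : u ∈ Icc (0 : ℝ) 1)
    (hv : v ∈ Icc (0 : ℝ) 1) : area hf hg u ≤ phi hf hg u v := by
  have := hhf.young hu hv
  rw [area_eq hhf hhg hu, phi]
  linarith

theorem integral_genInv_add (hhf : IsUpdate hf) (hhg : IsUpdate hg) (h : area hf hg 1 = 0) :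
    (∫ t in (0 : ℝ)..1, genInv hg t) + ∫ t in (0 : ℝ)..1, genInv hf t = 1 := by
  rw [area_eq hhf hhg (right_mem_Icc.2 zero_le_one)] at h
  rw [hhf.integral_genInv_one]
  linarith

theorem phi_swap (hf hg : ℝ → ℝ) (u v : ℝ) : phi hf hg u v = phi hg hf v u := by
  rw [phi, phi]
  ring

end Gap

/-! ### Weak fixed points -/

/-- The density evolution equations read through the quantiles of the profiles. -/
structure IsWeakFixedPoint (w hf hg f g : ℝ → ℝ) : Prop where
  eq_g : ∀ u ∈ Ioo (0 : ℝ) 1, genInv hg u = smooth w f (quantile g u)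
  eq_f : ∀ v ∈ Ioo (0 : ℝ) 1, genInv hf v = smooth w g (quantile f v)

section

variable {w hf hg f g f₀ g₀ f₁ g₁ : ℝ → ℝ}

theorem IsWeakFixedPoint.swap (h : IsWeakFixedPoint w hf hg f g) :
    IsWeakFixedPoint w hg hf g f := ⟨h.eq_f, h.eq_g⟩

/-- To the right of the quantile `g x ≥ u`, to the left `g x < u`; each side bounds `genInv hg u` by
values of the smoothed profile, whose continuity closes the gap even where `g` or `hg` jumps. -/
theorem genInv_eq_smooth_quantile (hw : IsWindow w) (hhg : IsUpdate hg) (hf' : IsCDF f)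
    (hg' : IsCDF g) (h : ∀ x, g x = hg (smooth w f x)) {u : ℝ} (hu : u ∈ Ioo (0 : ℝ) 1) :
    genInv hg u = smooth w f (quantile g u) := by
  have hc := (smooth_continuous hw hf').continuousAt (x := quantile g u)
  apply le_antisymm
  · refine ge_of_tendsto (hc.tendsto.mono_left (nhdsWithin_le_nhds (s := Ioi (quantile g u)))) ?_
    filter_upwards [self_mem_nhdsWithin] with x hx
    exact genInv_le (smooth_mem_Icc hw hf' x) (h x ▸ hg'.le_of_quantile_lt hu.2 hx)
  · refine le_of_tendsto (hc.tendsto.mono_left (nhdsWithin_le_nhds (s := Iio (quantile g u)))) ?_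
    filter_upwards [self_mem_nhdsWithin] with x hx
    exact hhg.le_genInv hu.2.le (smooth_mem_Icc hw hf' x).2 (h x ▸ hg'.lt_of_lt_quantile hu.1 hx)

theorem IsFixedPoint.isWeakFixedPoint (hw : IsWindow w) (hhf : IsUpdate hf) (hhg : IsUpdate hg)
    (hf' : IsCDF f) (hg' : IsCDF g) (h : IsFixedPoint w hf hg f g) :
    IsWeakFixedPoint w hf hg f g :=
  ⟨fun _ => genInv_eq_smooth_quantile hw hhg hf' hg' h.eq_g,
    fun _ => genInv_eq_smooth_quantile hw hhf hg' hf' h.eq_f⟩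

theorem integrable_windowCDF_quantile_sub (hw : IsWindow w) (hf' : IsCDF f) (hg' : IsCDF g) :
    Integrable (fun z : ℝ × ℝ => windowCDF w (quantile g z.1 - quantile f z.2))
      ((volume.restrict (Ioo 0 1)).prod (volume.restrict (Ioo 0 1))) :=
  integrable_windowCDF_comp hw
    (hg'.aemeasurable_quantile.comp_fst.sub hf'.aemeasurable_quantile.comp_snd)

theorem integrable_windowCDF_mul (hw : IsWindow w) (hf' : IsCDF f) (hg' : IsCDF g)
    {ψ : ℝ × ℝ → ℝ} (hψ : Integrable ψ
      ((volume.restrict (Ioo 0 1)).prod (volume.restrict (Ioo 0 1)))) :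
    Integrable (fun z : ℝ × ℝ => windowCDF w (quantile g z.1 - quantile f z.2) * ψ z)
      ((volume.restrict (Ioo 0 1)).prod (volume.restrict (Ioo 0 1))) :=
  hψ.bdd_mul (integrable_windowCDF_quantile_sub hw hf' hg').aestronglyMeasurable
    (ae_of_all _ fun _ => windowCDF_norm_le hw _)

theorem IsWeakFixedPoint.integral_mul_fst (hw : IsWindow w) (hf' : IsCDF f) (hg' : IsCDF g)
    (h : IsWeakFixedPoint w hf hg f g) {ψ : ℝ → ℝ}
    (hψ : Integrable ψ (volume.restrict (Ioo 0 1))) :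
    ∫ z : ℝ × ℝ, windowCDF w (quantile g z.1 - quantile f z.2) * ψ z.1
        ∂(volume.restrict (Ioo 0 1)).prod (volume.restrict (Ioo 0 1)) =
      ∫ u in Ioo (0 : ℝ) 1, genInv hg u * ψ u := by
  rw [integral_prod _ (integrable_windowCDF_mul hw hf' hg' (hψ.comp_fst _))]
  refine setIntegral_congr_fun measurableSet_Ioo fun u hu => ?_
  simp only
  rw [integral_mul_const, h.eq_g u hu, smooth_eq hw hf']

/-- The second marginal of the window mass; evenness of `w` turns `Ω(y - x)` into `1 - Ω(x - y)`. -/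
theorem IsWeakFixedPoint.integral_mul_snd (hw : IsWindow w) (hf' : IsCDF f) (hg' : IsCDF g)
    (h : IsWeakFixedPoint w hf hg f g) {ψ : ℝ → ℝ}
    (hψ : Integrable ψ (volume.restrict (Ioo 0 1))) :
    ∫ z : ℝ × ℝ, windowCDF w (quantile g z.1 - quantile f z.2) * ψ z.2
        ∂(volume.restrict (Ioo 0 1)).prod (volume.restrict (Ioo 0 1)) =
      ∫ v in Ioo (0 : ℝ) 1, (1 - genInv hf v) * ψ v := by
  rw [integral_prod_symm _ (integrable_windowCDF_mul hw hf' hg' (hψ.comp_snd _))]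
  refine setIntegral_congr_fun measurableSet_Ioo fun v hv => ?_
  simp only
  have h1 : ∀ u, windowCDF w (quantile g u - quantile f v) =
      1 - windowCDF w (quantile f v - quantile g u) := fun u => by
    rw [← windowCDF_neg hw, neg_sub]
  simp only [h1]
  rw [integral_mul_const, integral_sub (integrable_const _)
    (integrable_windowCDF_sub_quantile hw hg' _), h.eq_f v hv, smooth_eq hw hg']
  simp

/-- Two weak fixed points have the same window masses almost everywhere. -/
theorem IsWeakFixedPoint.ae_windowCDF_eq (hw : IsWindow w)
    (hf₀ : IsCDF f₀) (hg₀ : IsCDF g₀) (hf₁ : IsCDF f₁) (hg₁ : IsCDF g₁)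
    (if₀ : Integrable (quantile f₀) (volume.restrict (Ioo 0 1)))
    (ig₀ : Integrable (quantile g₀) (volume.restrict (Ioo 0 1)))
    (if₁ : Integrable (quantile f₁) (volume.restrict (Ioo 0 1)))
    (ig₁ : Integrable (quantile g₁) (volume.restrict (Ioo 0 1)))
    (h₀ : IsWeakFixedPoint w hf hg f₀ g₀) (h₁ : IsWeakFixedPoint w hf hg f₁ g₁) :
    ∀ᵐ z : ℝ × ℝ ∂(volume.restrict (Ioo 0 1)).prod (volume.restrict (Ioo 0 1)),
      windowCDF w (quantile g₀ z.1 - quantile f₀ z.2) =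
        windowCDF w (quantile g₁ z.1 - quantile f₁ z.2) := by
  let b₀ : ℝ × ℝ → ℝ := fun z => windowCDF w (quantile g₀ z.1 - quantile f₀ z.2)
  let b₁ : ℝ × ℝ → ℝ := fun z => windowCDF w (quantile g₁ z.1 - quantile f₁ z.2)
  let dg : ℝ → ℝ := fun u => quantile g₁ u - quantile g₀ u
  let df : ℝ → ℝ := fun v => quantile f₁ v - quantile f₀ v
  have hdg : Integrable dg (volume.restrict (Ioo 0 1)) := ig₁.sub ig₀
  have hdf : Integrable df (volume.restrict (Ioo 0 1)) := if₁.sub if₀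
  let μ : Measure (ℝ × ℝ) := (volume.restrict (Ioo 0 1)).prod (volume.restrict (Ioo 0 1))
  have i1g : Integrable (fun z => b₁ z * dg z.1) μ := integrable_windowCDF_mul hw hf₁ hg₁ (hdg.comp_fst (volume.restrict (Ioo 0 1)))
  have i0g : Integrable (fun z => b₀ z * dg z.1) μ := integrable_windowCDF_mul hw hf₀ hg₀ (hdg.comp_fst (volume.restrict (Ioo 0 1)))
  have i1f : Integrable (fun z => b₁ z * df z.2) μ := integrable_windowCDF_mul hw hf₁ hg₁ (hdf.comp_snd (volume.restrict (Ioo 0 1)))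
  have i0f : Integrable (fun z => b₀ z * df z.2) μ := integrable_windowCDF_mul hw hf₀ hg₀ (hdf.comp_snd (volume.restrict (Ioo 0 1)))
  have ig : Integrable (fun z => b₁ z * dg z.1 - b₀ z * dg z.1) μ := i1g.sub i0g
  have if' : Integrable (fun z => b₁ z * df z.2 - b₀ z * df z.2) μ := i1f.sub i0f
  -- Each of the four terms involves only one marginal of `b₀` or `b₁`, and the marginals are the
  -- same for both fixed points.
  have hzero : ∫ z, ((b₁ z * dg z.1 - b₀ z * dg z.1) - (b₁ z * df z.2 - b₀ z * df z.2))
      ∂μ = 0 := by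
    rw [integral_sub ig if', integral_sub i1g i0g, integral_sub i1f i0f,
      h₁.integral_mul_fst hw hf₁ hg₁ hdg, h₀.integral_mul_fst hw hf₀ hg₀ hdg,
      h₁.integral_mul_snd hw hf₁ hg₁ hdf, h₀.integral_mul_snd hw hf₀ hg₀ hdf]
    ring
  have hform : ∀ z, (b₁ z * dg z.1 - b₀ z * dg z.1) - (b₁ z * df z.2 - b₀ z * df z.2) =
      (b₁ z - b₀ z) * ((quantile g₁ z.1 - quantile f₁ z.2) -
        (quantile g₀ z.1 - quantile f₀ z.2)) := fun z => by
    simp only [dg, df]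
    ring
  have hnn : ∀ z, 0 ≤ (b₁ z * dg z.1 - b₀ z * dg z.1) - (b₁ z * df z.2 - b₀ z * df z.2) := by
    intro z
    rw [hform]
    rcases le_total (quantile g₁ z.1 - quantile f₁ z.2) (quantile g₀ z.1 - quantile f₀ z.2)
      with hle | hle
    · exact mul_nonneg_of_nonpos_of_nonpos (sub_nonpos.2 (windowCDF_mono hw hle))
        (sub_nonpos.2 hle)
    · exact mul_nonneg (sub_nonneg.2 (windowCDF_mono hw hle)) (sub_nonneg.2 hle)
  have hae := (integral_eq_zero_iff_of_nonneg hnn (ig.sub if')).1 hzero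
  filter_upwards [hae] with z hz
  have hz' : (b₁ z - b₀ z) * ((quantile g₁ z.1 - quantile f₁ z.2) -
      (quantile g₀ z.1 - quantile f₀ z.2)) = 0 := (hform z).symm.trans hz
  rcases mul_eq_zero.1 hz' with h | h
  · exact (sub_eq_zero.1 h).symm
  · rw [sub_eq_zero.1 h]

/-! ### From window masses to displacements -/

theorem exists_mem_Ioo_of_ae {P : ℝ → Prop} (h : ∀ᵐ x ∂(volume.restrict (Ioo (0 : ℝ) 1)), P x)
    {a u : ℝ} (hu : u ∈ Ioo (0 : ℝ) 1) (ha : a < u) : ∃ x ∈ Ioo a u, P x := by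
  rw [ae_restrict_iff' measurableSet_Ioo] at h
  have hpos : volume (Ioo (max a 0) u) ≠ 0 := by
    simp [ha, hu.1]
  obtain ⟨x, hx, hP⟩ := Frequently.exists (((frequently_ae_mem_iff.2 hpos)).and_eventually h)
  exact ⟨x, ⟨(le_max_left _ _).trans_lt hx.1, hx.2⟩,
    hP ⟨(le_max_right _ _).trans_lt hx.1, hx.2.trans hu.2⟩⟩

/-- If the displacements differed at `(u,v)`, left-continuity of the quantiles would keep them
different, with window mass strictly between `0` and `1`, on a rectangle just below `(u,v)`. Such a
rectangle contains a point where the masses agree, and injectivity of `Ω` contradicts this. -/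
theorem displacement_eq_of_ae (hw : IsWindow w) (hreg : IsRegular w)
    (hf₀ : IsCDF f₀) (hg₀ : IsCDF g₀) (hf₁ : IsCDF f₁) (hg₁ : IsCDF g₁)
    (hae : ∀ᵐ z : ℝ × ℝ ∂(volume.restrict (Ioo 0 1)).prod (volume.restrict (Ioo 0 1)),
      windowCDF w (quantile g₀ z.1 - quantile f₀ z.2) =
        windowCDF w (quantile g₁ z.1 - quantile f₁ z.2))
    {u v : ℝ} (hu : u ∈ Ioo (0 : ℝ) 1) (hv : v ∈ Ioo (0 : ℝ) 1)
    (h0 : 0 < windowCDF w (quantile g₀ u - quantile f₀ v))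
    (h1 : windowCDF w (quantile g₀ u - quantile f₀ v) < 1) :
    quantile g₁ u - quantile g₀ u = quantile f₁ v - quantile f₀ v := by
  by_contra hne
  have tb : ∀ {f g : ℝ → ℝ}, IsCDF f → IsCDF g →
      Tendsto (fun z : ℝ × ℝ => quantile g z.1 - quantile f z.2) (𝓝[<] u ×ˢ 𝓝[<] v)
        (𝓝 (quantile g u - quantile f v)) := fun hf hg =>
    ((hg.tendsto_quantile hu).comp tendsto_fst).sub ((hf.tendsto_quantile hv).comp tendsto_snd)
  have tB := ((windowCDF_continuous hw).tendsto _).comp (tb hf₀ hg₀)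
  have td := (tb hf₁ hg₁).sub (tb hf₀ hg₀)
  have hne' : quantile g₁ u - quantile f₁ v - (quantile g₀ u - quantile f₀ v) ≠ 0 := by
    intro h
    exact hne (by linarith)
  have hev := ((tB.eventually (lt_mem_nhds h0)).and (tB.eventually (gt_mem_nhds h1))).and
    (td.eventually_ne hne')
  obtain ⟨s, hs, t, ht, hst⟩ := mem_prod_iff.1 hev
  obtain ⟨a, ha, has⟩ := (mem_nhdsLT_iff_exists_Ioo_subset' hu.1).1 hs
  obtain ⟨c, hc, hct⟩ := (mem_nhdsLT_iff_exists_Ioo_subset' hv.1).1 ht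
  obtain ⟨x, hx, hxP⟩ := exists_mem_Ioo_of_ae (Measure.ae_ae_of_ae_prod hae) hu ha
  obtain ⟨y, hy, hxy⟩ := exists_mem_Ioo_of_ae hxP hv hc
  obtain ⟨⟨h2, h3⟩, h4⟩ := hst (mk_mem_prod (has hx) (hct hy))
  have := eq_of_windowCDF_eq hw hreg h2 h3 hxy
  exact h4 (sub_eq_zero.2 this.symm)

/-! ### Connectivity of a weak fixed point -/

theorem IsWeakFixedPoint.integral_indicator_fst (hw : IsWindow w) (hf' : IsCDF f)
    (hg' : IsCDF g) (h : IsWeakFixedPoint w hf hg f g) {u : ℝ} (hu : u ∈ Icc (0 : ℝ) 1) :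
    ∫ z : ℝ × ℝ, windowCDF w (quantile g z.1 - quantile f z.2) * (Iic u).indicator 1 z.1
        ∂(volume.restrict (Ioo 0 1)).prod (volume.restrict (Ioo 0 1)) =
      ∫ t in (0 : ℝ)..u, genInv hg t := by
  rw [h.integral_mul_fst hw hf' hg' (ψ := (Iic u).indicator 1)
    ((integrable_const (1 : ℝ)).indicator measurableSet_Iic), ← integral_indicator_Iic_unit hu]
  congr 1
  funext t
  by_cases ht : t ≤ u <;> simp [ht]

/-- The two rectangle conditions say that `b 1_{u ≤ u₀} + (1 - b) 1_{v ≤ v₀} = 1_{u ≤ u₀} 1_{v ≤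
v₀}` almost everywhere. Integrating with the known marginals gives `∫₀^{u₀} h_g⁻¹ + ∫₀^{v₀} h_f⁻¹ =
u₀ v₀`. -/
theorem IsWeakFixedPoint.phi_eq_zero (hw : IsWindow w) (hf' : IsCDF f) (hg' : IsCDF g)
    (hhf : IsUpdate hf) (h : IsWeakFixedPoint w hf hg f g) {u₀ v₀ : ℝ} (hu : u₀ ∈ Icc (0 : ℝ) 1)
    (hv : v₀ ∈ Icc (0 : ℝ) 1)
    (h0 : ∀ u ∈ Ioo 0 u₀, ∀ v ∈ Ioo v₀ 1, windowCDF w (quantile g u - quantile f v) = 0)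
    (h1 : ∀ u ∈ Ioo u₀ 1, ∀ v ∈ Ioo 0 v₀, windowCDF w (quantile g u - quantile f v) = 1) :
    phi hf hg u₀ v₀ = 0 := by
  let μ : Measure (ℝ × ℝ) := (volume.restrict (Ioo 0 1)).prod (volume.restrict (Ioo 0 1))
  let b : ℝ × ℝ → ℝ := fun z => windowCDF w (quantile g z.1 - quantile f z.2)
  let χ : ℝ → ℝ → ℝ := fun a => (Iic a).indicator 1
  have hχ : ∀ a, Integrable (χ a) (volume.restrict (Ioo 0 1)) := fun a =>
    (integrable_const (1 : ℝ)).indicator measurableSet_Iic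
  have hχi : ∀ a ∈ Icc (0 : ℝ) 1, ∫ t in Ioo (0 : ℝ) 1, χ a t = a := fun a ha => by
    simp only [χ]
    rw [integral_indicator_Iic_unit ha]
    simp
  have i1 : Integrable (fun z => b z * χ u₀ z.1) μ :=
    integrable_windowCDF_mul hw hf' hg' ((hχ u₀).comp_fst _)
  have i2 : Integrable (fun z => b z * χ v₀ z.2) μ :=
    integrable_windowCDF_mul hw hf' hg' ((hχ v₀).comp_snd _)
  have i3 : Integrable (fun z : ℝ × ℝ => χ v₀ z.2) μ := (hχ v₀).comp_snd _
  have i4 : Integrable (fun z : ℝ × ℝ => χ u₀ z.1 * χ v₀ z.2) μ := (hχ u₀).mul_prod (hχ v₀)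
  have e1 : ∫ z, b z * χ u₀ z.1 ∂μ = ∫ t in (0 : ℝ)..u₀, genInv hg t :=
    h.integral_indicator_fst hw hf' hg' hu
  have e2 : ∫ z, b z * χ v₀ z.2 ∂μ = v₀ - ∫ t in (0 : ℝ)..v₀, genInv hf t := by
    rw [h.integral_mul_snd hw hf' hg' (hχ v₀)]
    have : ∀ t, (1 - genInv hf t) * χ v₀ t = (Iic v₀).indicator (fun t => 1 - genInv hf t) t := by
      intro t
      by_cases ht : t ≤ v₀ <;> simp [χ, ht]
    simp only [this]
    rw [integral_indicator_Iic_unit hv, intervalIntegral.integral_sub (by simp)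
      (hhf.genInv_intervalIntegrable zero_le_one hv.2)]
    simp
  have e3 : ∫ z : ℝ × ℝ, χ v₀ z.2 ∂μ = v₀ := by
    rw [integral_fun_snd, hχi v₀ hv]
    simp
  have e4 : ∫ z : ℝ × ℝ, χ u₀ z.1 * χ v₀ z.2 ∂μ = u₀ * v₀ := by
    rw [integral_prod_mul, hχi v₀ hv, hχi u₀ hu]
  have hne1 : ∀ᵐ z ∂μ, z.1 ≠ u₀ ∧ z.1 ∈ Ioo (0 : ℝ) 1 :=
    Measure.quasiMeasurePreserving_fst.ae
      ((Measure.ae_ne _ _).and (ae_restrict_mem measurableSet_Ioo))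
  have hne2 : ∀ᵐ z ∂μ, z.2 ≠ v₀ ∧ z.2 ∈ Ioo (0 : ℝ) 1 :=
    Measure.quasiMeasurePreserving_snd.ae
      ((Measure.ae_ne _ _).and (ae_restrict_mem measurableSet_Ioo))
  have hz : ∫ z, ((b z * χ u₀ z.1 - b z * χ v₀ z.2) + χ v₀ z.2) - χ u₀ z.1 * χ v₀ z.2 ∂μ = 0 := by
    refine integral_eq_zero_of_ae ?_
    filter_upwards [hne1, hne2] with z ⟨z1, z2⟩ ⟨z3, z4⟩
    rcases lt_or_gt_of_ne z1 with hu' | hu' <;> rcases lt_or_gt_of_ne z3 with hv' | hv'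
    · simp [χ, hu'.le, hv'.le]
    · have : b z = 0 := h0 z.1 ⟨z2.1, hu'⟩ z.2 ⟨hv', z4.2⟩
      simp [χ, hu'.le, hv', this]
    · have : b z = 1 := h1 z.1 ⟨hu', z2.2⟩ z.2 ⟨z4.1, hv'⟩
      simp [χ, hv'.le, hu', this]
    · simp [χ, hu', hv']
  have i5 : Integrable (fun z => b z * χ u₀ z.1 - b z * χ v₀ z.2) μ := i1.sub i2
  have i6 : Integrable (fun z => b z * χ u₀ z.1 - b z * χ v₀ z.2 + χ v₀ z.2) μ := i5.add i3
  rw [integral_sub i6 i4, integral_add i5 i3, integral_sub i1 i2,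
    e1, e2, e3, e4] at hz
  rw [phi]
  linarith

/-- Around every level `u₀` at which `φ` does not vanish, the levels of `g` have a common
neighbour among the levels of `f`. -/
theorem IsWeakFixedPoint.exists_common_neighbour (hw : IsWindow w) (hf' : IsCDF f)
    (hg' : IsCDF g) (hhf : IsUpdate hf) (h : IsWeakFixedPoint w hf hg f g) {u₀ : ℝ}
    (hu : u₀ ∈ Ioo (0 : ℝ) 1) (hpos : ∀ v ∈ Icc (0 : ℝ) 1, 0 < phi hf hg u₀ v) :
    ∃ a ∈ Ioo 0 u₀, ∃ b ∈ Ioo u₀ 1, ∃ v ∈ Ioo (0 : ℝ) 1, ∀ t ∈ Icc a b,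
      0 < windowCDF w (quantile g t - quantile f v) ∧
        windowCDF w (quantile g t - quantile f v) < 1 := by
  by_contra hcon
  push Not at hcon
  -- The mass increases with the level of `g`: positive at `a` and equal to `1` somewhere in `[a,
  -- b]`, it is `1` at `b`.
  have hcon' : ∀ a ∈ Ioo 0 u₀, ∀ b ∈ Ioo u₀ 1, ∀ v ∈ Ioo (0 : ℝ) 1,
      0 < windowCDF w (quantile g a - quantile f v) →
        windowCDF w (quantile g b - quantile f v) = 1 := by
    intro a ha b hb v hv hav
    obtain ⟨t, ht, hlt⟩ := hcon a ha b hb v hv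
    have ha1 : a ∈ Ioo (0 : ℝ) 1 := ⟨ha.1, ha.2.trans hu.2⟩
    have hb1 : b ∈ Ioo (0 : ℝ) 1 := ⟨hu.1.trans hb.1, hb.2⟩
    have ht1 : t ∈ Ioo (0 : ℝ) 1 := ⟨ha.1.trans_le ht.1, ht.2.trans_lt hb.2⟩
    have m1 := windowCDF_mono hw (sub_le_sub_right
      (hg'.quantile_monotoneOn ha1 ht1 ht.1) (quantile f v))
    have m2 := windowCDF_mono hw (sub_le_sub_right
      (hg'.quantile_monotoneOn ht1 hb1 ht.2) (quantile f v))
    exact le_antisymm (windowCDF_le_one hw _) ((hlt (hav.trans_le m1)).trans m2)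
  -- The corner `v₀` is the supremum of the levels of `f` seen with positive mass from below `u₀`;
  -- inserting `0` covers the case where there are none.
  let S : Set ℝ := insert 0 {v | v ∈ Ioo (0 : ℝ) 1 ∧ ∃ a ∈ Ioo 0 u₀,
    0 < windowCDF w (quantile g a - quantile f v)}
  have hS1 : ∀ v ∈ S, v ≤ 1 := by
    rintro v (rfl | hv)
    · exact zero_le_one
    · exact hv.1.2.le
  have hbdd : BddAbove S := ⟨1, hS1⟩
  have h0S : (0 : ℝ) ∈ S := mem_insert _ _
  have hv₀ : sSup S ∈ Icc (0 : ℝ) 1 := ⟨le_csSup hbdd h0S, csSup_le ⟨0, h0S⟩ hS1⟩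
  refine (hpos _ hv₀).ne' (h.phi_eq_zero hw hf' hg' hhf ⟨hu.1.le, hu.2.le⟩ hv₀ ?_ ?_)
  · intro u hu' v hv
    by_contra hne
    have hvS : v ∈ S := mem_insert_of_mem _ ⟨⟨hv₀.1.trans_lt hv.1, hv.2⟩, u, hu',
      lt_of_le_of_ne (windowCDF_nonneg hw _) (Ne.symm hne)⟩
    exact absurd (le_csSup hbdd hvS) (not_le.mpr hv.1)
  · intro u hu' v hv
    obtain ⟨v', hv'S, hlt⟩ := exists_lt_of_lt_csSup ⟨0, h0S⟩ hv.2
    rcases hv'S with rfl | ⟨hv'1, a, ha, hpos'⟩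
    · exact absurd hv.1 (not_lt.mpr hlt.le)
    · have hv1 : v ∈ Ioo (0 : ℝ) 1 := ⟨hv.1, hlt.trans hv'1.2⟩
      refine hcon' a ha u hu' v hv1 (hpos'.trans_le (windowCDF_mono hw ?_))
      exact sub_le_sub_left (hf'.quantile_monotoneOn hv1 hv'1 hlt.le) _

/-- If `φ` does not vanish at interior levels of `g`, the displacement of `g` is constant. -/
theorem IsWeakFixedPoint.exists_displacement (hw : IsWindow w) (hf' : IsCDF f₀)
    (hg' : IsCDF g₀) (hhf : IsUpdate hf) (h : IsWeakFixedPoint w hf hg f₀ g₀)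
    (hpos : ∀ u ∈ Ioo (0 : ℝ) 1, ∀ v ∈ Icc (0 : ℝ) 1, 0 < phi hf hg u v)
    {df dg : ℝ → ℝ} (hd : ∀ u ∈ Ioo (0 : ℝ) 1, ∀ v ∈ Ioo (0 : ℝ) 1,
      0 < windowCDF w (quantile g₀ u - quantile f₀ v) →
      windowCDF w (quantile g₀ u - quantile f₀ v) < 1 → dg u = df v) :
    ∃ c, (∀ u ∈ Ioo (0 : ℝ) 1, dg u = c) ∧ ∃ v ∈ Ioo (0 : ℝ) 1, df v = c := by
  have hhalf : (1 / 2 : ℝ) ∈ Ioo (0 : ℝ) 1 := by norm_num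
  have hloc : ∀ u ∈ Ioo (0 : ℝ) 1, ∃ a ∈ Ioo 0 u, ∃ b ∈ Ioo u 1, ∃ v ∈ Ioo (0 : ℝ) 1,
      ∀ t ∈ Icc a b, dg t = df v := by
    intro u hu
    obtain ⟨a, ha, b, hb, v, hv, H⟩ :=
      h.exists_common_neighbour hw hf' hg' hhf hu (hpos u hu)
    exact ⟨a, ha, b, hb, v, hv, fun t ht => hd t ⟨ha.1.trans_le ht.1, ht.2.trans_lt hb.2⟩ v hv
      (H t ht).1 (H t ht).2⟩
  refine ⟨dg (1 / 2), fun u hu => ?_, ?_⟩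
  -- A common neighbour makes the displacement constant near each level, and `(0,1)` is connected.
  · refine isPreconnected_Ioo.induction₂ (fun x y => dg x = dg y) (fun x hx => ?_)
      (fun x y z _ _ _ h1 h2 => h1.trans h2) (fun x y _ _ h1 => h1.symm) hu hhalf
    obtain ⟨a, ha, b, hb, v, _, H⟩ := hloc x hx
    filter_upwards [mem_nhdsWithin_of_mem_nhds (Icc_mem_nhds ha.2 hb.1)] with y hy
    rw [H x ⟨ha.2.le, hb.1.le⟩, H y hy]
  · obtain ⟨a, ha, b, hb, v, hv, H⟩ := hloc _ hhalf
    exact ⟨v, hv, (H _ ⟨ha.2.le, hb.1.le⟩).symm⟩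

end

/-! ### Translates -/

section

variable {w hf hg f₀ g₀ f₁ g₁ p₀ p₁ : ℝ → ℝ} {c : ℝ}

theorem isTranslateAE_of_quantile (h₀ : IsCDF p₀) (h₁ : IsCDF p₁)
    (h : ∀ u ∈ Ioo (0 : ℝ) 1, quantile p₁ u - quantile p₀ u = c) : IsTranslateAE c p₀ p₁ := by
  have hc : ∀ᵐ x : ℝ, ContinuousAt p₀ (x - c) :=
    (measurePreserving_sub_right volume c).quasiMeasurePreserving.ae h₀.ae_continuousAt
  filter_upwards [hc, h₁.ae_continuousAt] with x hx0 hx1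
  apply le_antisymm
  · refine le_of_forall_gt_imp_ge_of_dense fun u hu => ?_
    by_contra hlt
    obtain ⟨t, ht1, ht2⟩ := exists_between (not_le.mp hlt)
    have ht : t ∈ Ioo (0 : ℝ) 1 :=
      ⟨(h₀.nonneg _).trans_lt (hu.trans ht1), ht2.trans_le (h₁.le_one _)⟩
    have h2 := (h₁.quantile_le_iff ht hx1).2 ht2.le
    have h3 : quantile p₀ t ≤ x - c := by linarith [h t ht]
    exact absurd ((h₀.quantile_le_iff ht hx0).1 h3) (not_le.mpr (hu.trans ht1))
  · refine le_of_forall_gt_imp_ge_of_dense fun u hu => ?_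
    by_contra hlt
    obtain ⟨t, ht1, ht2⟩ := exists_between (not_le.mp hlt)
    have ht : t ∈ Ioo (0 : ℝ) 1 :=
      ⟨(h₁.nonneg _).trans_lt (hu.trans ht1), ht2.trans_le (h₀.le_one _)⟩
    have h2 := (h₀.quantile_le_iff ht hx0).2 ht2.le
    have h3 : quantile p₁ t ≤ x := by linarith [h t ht]
    exact absurd ((h₁.quantile_le_iff ht hx1).1 h3) (not_le.mpr (hu.trans ht1))

theorem smooth_eq_of_quantile (hw : IsWindow w) (h₀ : IsCDF p₀) (h₁ : IsCDF p₁)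
    (h : ∀ u ∈ Ioo (0 : ℝ) 1, quantile p₁ u - quantile p₀ u = c) (x : ℝ) :
    smooth w p₁ x = smooth w p₀ (x - c) := by
  rw [smooth_eq hw h₁, smooth_eq hw h₀]
  refine setIntegral_congr_fun measurableSet_Ioo fun u hu => ?_
  congr 1
  linarith [h u hu]

/-- The transport map can be read off only at points `y` that do not end, or lie in, a flat stretch
on their left. For each rational `q` the points joined to `q` by a flat stretch have measure zero,
and there are countably many `q`. -/
theorem ae_rightLim_ne (hp : Monotone p₀) :
    ∀ᵐ y ∂(profileMeasure hp), ∀ q : ℚ, (q : ℝ) < y →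
      Function.rightLim p₀ q ≠ Function.rightLim p₀ y := by
  rw [ae_all_iff]
  intro q
  rw [ae_iff]
  have hIoc : ∀ y : ℝ, Function.rightLim p₀ q = Function.rightLim p₀ y →
      profileMeasure hp (Ioc (q : ℝ) y) = 0 := by
    intro y hy
    rw [profileMeasure, StieltjesFunction.measure_Ioc, hp.stieltjesFunction_eq,
      hp.stieltjesFunction_eq, hy, sub_self, ENNReal.ofReal_zero]
  refine measure_null_of_locally_null _ fun y hy => ?_
  push Not at hy
  obtain ⟨hqy, hy⟩ := hy
  -- Either the flat stretch continues beyond `y` and covers a neighbourhood, or `y` is its last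
  -- point and nothing of the set lies further right.
  by_cases hmax : ∃ z, y < z ∧ Function.rightLim p₀ q = Function.rightLim p₀ z
  · obtain ⟨z, hyz, hz⟩ := hmax
    exact ⟨Ioc (q : ℝ) z, mem_nhdsWithin_of_mem_nhds (Ioc_mem_nhds hqy hyz), hIoc z hz⟩
  · refine ⟨Ioc (q : ℝ) y, ?_, hIoc y hy⟩
    filter_upwards [self_mem_nhdsWithin] with z hz
    push Not at hz
    exact ⟨hz.1, not_lt.mp fun hlt => hmax ⟨z, hlt, hz.2⟩⟩

theorem ae_transportMap_eq (h₀ : IsCDF p₀) (h : ∀ x, p₁ x = p₀ (x - c)) :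
    ∀ᵐ y ∂(profileMeasure h₀.mono), y - transportMap p₀ p₁ y = -c := by
  filter_upwards [ae_rightLim_ne h₀.mono] with y hy
  have hpos : 0 < Function.rightLim p₀ y := by
    obtain ⟨q, hq⟩ := exists_rat_lt y
    exact lt_of_le_of_lt ((h₀.nonneg q).trans (h₀.mono.le_rightLim le_rfl))
      (lt_of_le_of_ne (h₀.mono.rightLim hq.le) (hy q hq))
  have key : IsGLB {x | Function.rightLim p₀ y ≤ p₁ x} (y + c) := by
    constructor
    · intro x hx
      by_contra hlt
      have hlt' : x - c < y := by linarith [not_le.mp hlt]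
      obtain ⟨q, hq1, hq2⟩ := exists_rat_btwn hlt'
      refine hy q hq2 (le_antisymm (h₀.mono.rightLim hq2.le) ?_)
      rw [mem_ofPred_eq, h] at hx
      exact hx.trans (h₀.mono.le_rightLim hq1.le)
    · intro b hb
      refine le_of_forall_gt_imp_ge_of_dense fun x hx => hb ?_
      rw [mem_ofPred_eq, h]
      exact h₀.mono.rightLim_le (by linarith)
  have hne : {x | Function.rightLim p₀ y ≤ p₁ x}.Nonempty := by
    refine ⟨y + c + 1, ?_⟩
    rw [mem_ofPred_eq, h]
    exact h₀.mono.rightLim_le (by linarith)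
  rw [transportMap, quantile, key.csInf_eq hne]
  ring

theorem StrictlyPositiveGap.phi_pos (hhf : IsUpdate hf) (hhg : IsUpdate hg)
    (hgap : StrictlyPositiveGap hf hg) {u v : ℝ} (hu : u ∈ Ioo (0 : ℝ) 1)
    (hv : v ∈ Icc (0 : ℝ) 1) : 0 < phi hf hg u v :=
  (hgap.1 u hu).trans_le (area_le_phi hhf hhg ⟨hu.1.le, hu.2.le⟩ hv)

/-- With the roles exchanged, positivity of `φ` is needed at interior `v` also for `u = 0` and `u =
1`; `phi_pos`, which rests on the area, covers only interior `u`. -/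
theorem StrictlyPositiveGapPhi.swap_pos (h : StrictlyPositiveGapPhi hf hg) {u v : ℝ}
    (hu : u ∈ Ioo (0 : ℝ) 1) (hv : v ∈ Icc (0 : ℝ) 1) : 0 < phi hg hf u v := by
  rw [phi_swap]
  refine h.1 v hv u ⟨hu.1.le, hu.2.le⟩ ?_ ?_
  · intro he
    exact hu.1.ne' (Prod.ext_iff.1 he).2
  · intro he
    exact hu.2.ne (Prod.ext_iff.1 he).2

/-- A pair whose window masses agree almost everywhere with those of a weak fixed point is a
translate of it: always in the `g`-component, and in both under the two-variable gap condition. -/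
theorem IsWeakFixedPoint.exists_displacement_of_ae (hw : IsWindow w) (hreg : IsRegular w)
    (hhf : IsUpdate hf) (hhg : IsUpdate hg) (hgap : StrictlyPositiveGap hf hg)
    (hf₀ : IsCDF f₀) (hg₀ : IsCDF g₀) (hf₁ : IsCDF f₁) (hg₁ : IsCDF g₁)
    (h₀ : IsWeakFixedPoint w hf hg f₀ g₀)
    (hae : ∀ᵐ z : ℝ × ℝ ∂(volume.restrict (Ioo 0 1)).prod (volume.restrict (Ioo 0 1)),
      windowCDF w (quantile g₀ z.1 - quantile f₀ z.2) =
        windowCDF w (quantile g₁ z.1 - quantile f₁ z.2)) :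
    ∃ c, (∀ u ∈ Ioo (0 : ℝ) 1, quantile g₁ u - quantile g₀ u = c) ∧
      (StrictlyPositiveGapPhi hf hg →
        ∀ v ∈ Ioo (0 : ℝ) 1, quantile f₁ v - quantile f₀ v = c) := by
  have hd : ∀ u ∈ Ioo (0 : ℝ) 1, ∀ v ∈ Ioo (0 : ℝ) 1,
      0 < windowCDF w (quantile g₀ u - quantile f₀ v) →
      windowCDF w (quantile g₀ u - quantile f₀ v) < 1 →
      quantile g₁ u - quantile g₀ u = quantile f₁ v - quantile f₀ v :=
    fun u hu v hv => displacement_eq_of_ae hw hreg hf₀ hg₀ hf₁ hg₁ hae hu hv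
  obtain ⟨c, hc, v₁, hv₁, hc₁⟩ := h₀.exists_displacement hw hf₀ hg₀ hhf
    (fun u hu v hv => hgap.phi_pos hhf hhg hu hv) (df := fun v => quantile f₁ v - quantile f₀ v)
    (dg := fun u => quantile g₁ u - quantile g₀ u) hd
  refine ⟨c, hc, fun hPhi v hv => ?_⟩
  obtain ⟨c', hc', -⟩ := h₀.swap.exists_displacement hw hg₀ hf₀ hhg
    (fun u hu v hv => hPhi.swap_pos hu hv) (df := fun u => quantile g₁ u - quantile g₀ u)
    (dg := fun v => quantile f₁ v - quantile f₀ v) (fun v hv u hu h1 h2 => by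
      -- Exchanging `f` and `g` replaces the mass `b` by `1 - b`, so being strictly between `0` and
      -- `1` is symmetric.
      rw [← neg_sub, windowCDF_neg hw] at h1 h2
      exact (hd u hu v hv (by linarith) (by linarith)).symm)
  exact (hc' v hv).trans ((hc' v₁ hv₁).symm.trans hc₁)

/-- Two weak fixed points are translates of each other. -/
theorem IsWeakFixedPoint.exists_displacement_of_isWeakFixedPoint (hw : IsWindow w)
    (hreg : IsRegular w) (hhf : IsUpdate hf) (hhg : IsUpdate hg)
    (hgap : StrictlyPositiveGap hf hg) {ε : ℝ} (hε : 0 < ε)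
    (hp₀ : IsMonotonePair ε f₀ g₀) (hp₁ : IsMonotonePair ε f₁ g₁)
    (h₀ : IsWeakFixedPoint w hf hg f₀ g₀) (h₁ : IsWeakFixedPoint w hf hg f₁ g₁) :
    ∃ c, (∀ u ∈ Ioo (0 : ℝ) 1, quantile g₁ u - quantile g₀ u = c) ∧
      (StrictlyPositiveGapPhi hf hg →
        ∀ v ∈ Ioo (0 : ℝ) 1, quantile f₁ v - quantile f₀ v = c) :=
  h₀.exists_displacement_of_ae hw hreg hhf hhg hgap (hp₀.isCDF_f hε) (hp₀.isCDF_g hε)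
    (hp₁.isCDF_f hε) (hp₁.isCDF_g hε)
    (IsWeakFixedPoint.ae_windowCDF_eq hw (hp₀.isCDF_f hε) (hp₀.isCDF_g hε) (hp₁.isCDF_f hε)
      (hp₁.isCDF_g hε) (hp₀.integrable_quantile_f hε) (hp₀.integrable_quantile_g hε)
      (hp₁.integrable_quantile_f hε) (hp₁.integrable_quantile_g hε) h₀ h₁)

/-- Only the displacement of `g` is used: it translates `g ⊗ w`, and the equations then give `f` and
afterwards `g` at every point, without `(Φ)`. -/
theorem IsFixedPoint.exists_translate (hw : IsWindow w) (hreg : IsRegular w)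
    (hhf : IsUpdate hf) (hhg : IsUpdate hg) (hgap : StrictlyPositiveGap hf hg) {ε : ℝ}
    (hε : 0 < ε) (hp₀ : IsMonotonePair ε f₀ g₀) (hp₁ : IsMonotonePair ε f₁ g₁)
    (h₀ : IsFixedPoint w hf hg f₀ g₀) (h₁ : IsFixedPoint w hf hg f₁ g₁) :
    ∃ c, (∀ x, f₁ x = f₀ (x - c)) ∧ ∀ x, g₁ x = g₀ (x - c) := by
  obtain ⟨c, hc, -⟩ :=
    (h₀.isWeakFixedPoint hw hhf hhg (hp₀.isCDF_f hε)
      (hp₀.isCDF_g hε)).exists_displacement_of_isWeakFixedPoint hw hreg hhf hhg hgap hε hp₀ hp₁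
      (h₁.isWeakFixedPoint hw hhf hhg (hp₁.isCDF_f hε) (hp₁.isCDF_g hε))
  have hfx : ∀ x, f₁ x = f₀ (x - c) := fun x => by
    rw [h₁.eq_f, h₀.eq_f, smooth_eq_of_quantile hw (hp₀.isCDF_g hε) (hp₁.isCDF_g hε) hc]
  refine ⟨c, hfx, fun x => ?_⟩
  rw [h₁.eq_g, h₀.eq_g, funext hfx, smooth_comp_sub]

end

/-! ### The interaction kernel -/

/-- `E[max(t, S)]` for a random variable `S` with density `w`. -/
def windowMax (w : ℝ → ℝ) (t : ℝ) : ℝ := ∫ s, max t s * w s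

section Kernel

variable {w : ℝ → ℝ}

theorem integrable_id_mul (hw : IsWindow w) (hm : Integrable fun x : ℝ => |x| * w x) :
    Integrable fun s : ℝ => s * w s := by
  refine hm.mono' (measurable_id.aestronglyMeasurable.mul hw.integrable.aestronglyMeasurable)
    (ae_of_all _ fun s => ?_)
  rw [norm_mul, Real.norm_eq_abs, Real.norm_eq_abs, abs_of_nonneg (hw.nonneg s)]

theorem integrable_max_mul (hw : IsWindow w) (hm : Integrable fun x : ℝ => |x| * w x) (t : ℝ) :
    Integrable fun s : ℝ => max t s * w s := by
  have h : (fun s : ℝ => max t s * w s) = (fun s => t * w s) ⊔ fun s => s * w s := by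
    funext s
    exact max_mul_of_nonneg t s (hw.nonneg s)
  rw [h]
  exact (hw.integrable.const_mul t).sup (integrable_id_mul hw hm)

/-- An even window has mean zero and `max(-t,-s) = max(t,s) - t - s`. This is what makes the
potential symmetric in its two components. -/
theorem windowMax_neg (hw : IsWindow w) (hm : Integrable fun x : ℝ => |x| * w x) (t : ℝ) :
    windowMax w (-t) = windowMax w t - t := by
  have h0 : ∫ s, s * w s = 0 := by
    have h := integral_neg_eq_self (fun s : ℝ => s * w s) volume
    simp only [hw.even, neg_mul, integral_neg] at h
    linarith
  have h1 : windowMax w (-t) = ∫ s, max (-t) (-s) * w (-s) :=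
    (integral_neg_eq_self (fun s : ℝ => max (-t) s * w s) volume).symm
  have h2 : ∀ s, max (-t) (-s) * w (-s) = max t s * w s - t * w s - s * w s := fun s => by
    rw [hw.even, max_neg_neg]
    have := min_add_max t s
    rw [← sub_mul, ← sub_mul]
    congr 1
    linarith
  have i1 : Integrable fun s => max t s * w s - t * w s :=
    (integrable_max_mul hw hm t).sub (hw.integrable.const_mul t)
  rw [h1]
  simp only [h2]
  rw [integral_sub i1 (integrable_id_mul hw hm),
    integral_sub (integrable_max_mul hw hm t) (hw.integrable.const_mul t), h0,
    integral_const_mul, hw.integral_eq_one, windowMax]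
  ring

/-- For fixed `s`, the indicator of `s ≤ a` is a subgradient of `max · s` at `a`; its mean is
`Ω(a)`. -/
theorem windowMax_subgradient (hw : IsWindow w) (hm : Integrable fun x : ℝ => |x| * w x)
    (a b : ℝ) : windowMax w a + windowCDF w a * (b - a) ≤ windowMax w b := by
  have h1 : windowCDF w a * (b - a) = ∫ s, (Iic a).indicator w s * (b - a) := by
    rw [integral_mul_const, integral_indicator measurableSet_Iic, windowCDF]
  have i1 : Integrable fun s => (Iic a).indicator w s * (b - a) :=
    (hw.integrable.indicator measurableSet_Iic).mul_const _
  rw [h1, windowMax, windowMax, ← integral_add (integrable_max_mul hw hm a) i1]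
  refine integral_mono ((integrable_max_mul hw hm a).add i1) (integrable_max_mul hw hm b)
    fun s => ?_
  have hs := hw.nonneg s
  by_cases h : s ≤ a
  · simp only [indicator, mem_Iic, h, if_true, max_eq_left]
    have := mul_le_mul_of_nonneg_right (le_max_left b s) hs
    linarith
  · simp only [indicator, mem_Iic, h, if_false, zero_mul, add_zero, max_eq_right (not_le.mp h).le]
    exact mul_le_mul_of_nonneg_right (le_max_right b s) hs

/-- Equality in the subgradient inequality forces equality of the slopes. -/
theorem windowCDF_eq_of_windowMax_le (hw : IsWindow w)
    (hm : Integrable fun x : ℝ => |x| * w x) {a c : ℝ}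
    (h : windowMax w a ≤ windowMax w c + windowCDF w c * (a - c)) :
    windowCDF w a = windowCDF w c := by
  -- The tangent at `c` touches the graph at `a`, so from any `x` the slope towards `a` compares
  -- with the slope at `c`; below, `x` tends to `a` from the side of `c`.
  have key : ∀ x, windowCDF w x * (a - x) ≤ windowCDF w c * (a - x) := fun x => by
    have h1 := windowMax_subgradient hw hm x a
    have h2 := windowMax_subgradient hw hm c x
    linarith
  have hc := (windowCDF_continuous hw).tendsto a
  rcases lt_trichotomy a c with hac | hac | hac
  · refine le_antisymm (windowCDF_mono hw hac.le) ?_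
    refine ge_of_tendsto (hc.mono_left (nhdsWithin_le_nhds (s := Ioi a))) ?_
    filter_upwards [self_mem_nhdsWithin] with x hx
    exact (mul_le_mul_right_of_neg (sub_neg.2 hx)).1 (key x)
  · rw [hac]
  · refine le_antisymm ?_ (windowCDF_mono hw hac.le)
    refine le_of_tendsto (hc.mono_left (nhdsWithin_le_nhds (s := Iio a))) ?_
    filter_upwards [self_mem_nhdsWithin] with x hx
    exact le_of_mul_le_mul_right (key x) (sub_pos.2 hx)

theorem windowMax_convex (hw : IsWindow w) (hm : Integrable fun x : ℝ => |x| * w x)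
    {l : ℝ} (hl : l ∈ Ioo (0 : ℝ) 1) (a b : ℝ) :
    windowMax w ((1 - l) * a + l * b) ≤ (1 - l) * windowMax w a + l * windowMax w b := by
  have h1 := windowMax_subgradient hw hm ((1 - l) * a + l * b) a
  have h2 := windowMax_subgradient hw hm ((1 - l) * a + l * b) b
  have h3 := mul_le_mul_of_nonneg_left h1 (sub_nonneg.2 hl.2.le)
  have h4 := mul_le_mul_of_nonneg_left h2 hl.1.le
  linarith

theorem windowCDF_eq_of_windowMax_convex (hw : IsWindow w)
    (hm : Integrable fun x : ℝ => |x| * w x) {l : ℝ} (hl : l ∈ Ioo (0 : ℝ) 1) {a b : ℝ}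
    (h : (1 - l) * windowMax w a + l * windowMax w b ≤ windowMax w ((1 - l) * a + l * b)) :
    windowCDF w a = windowCDF w b := by
  set c := (1 - l) * a + l * b with hc
  have h1 := windowMax_subgradient hw hm c a
  have h2 := windowMax_subgradient hw hm c b
  have h3 := mul_le_mul_of_nonneg_left h1 (sub_nonneg.2 hl.2.le)
  have h4 := mul_le_mul_of_nonneg_left h2 hl.1.le
  -- As `c` is the barycentre, the slope terms cancel, so both subgradient inequalities must be
  -- equalities.
  have hz : (1 - l) * (windowCDF w c * (a - c)) + l * (windowCDF w c * (b - c)) = 0 := by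
    rw [hc]
    ring
  have ea : windowMax w a ≤ windowMax w c + windowCDF w c * (a - c) := by
    have : (1 - l) * windowMax w a ≤
        (1 - l) * (windowMax w c + windowCDF w c * (a - c)) := by linarith
    exact le_of_mul_le_mul_left this (sub_pos.2 hl.2)
  have eb : windowMax w b ≤ windowMax w c + windowCDF w c * (b - c) := by
    have : l * windowMax w b ≤ l * (windowMax w c + windowCDF w c * (b - c)) := by linarith
    exact le_of_mul_le_mul_left this hl.1
  rw [windowCDF_eq_of_windowMax_le hw hm ea, windowCDF_eq_of_windowMax_le hw hm eb]

end Kernel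

/-! ### The potential in terms of quantiles -/

/-- Distribution functions with integrable quantile. -/
structure IsIntegrableCDF (p : ℝ → ℝ) : Prop extends IsCDF p where
  integrable : Integrable (quantile p) (volume.restrict (Ioo 0 1))

theorem IsMonotonePair.isIntegrableCDF_f {ε : ℝ} {f g : ℝ → ℝ} (h : IsMonotonePair ε f g)
    (hε : 0 < ε) : IsIntegrableCDF f := ⟨h.isCDF_f hε, h.integrable_quantile_f hε⟩

theorem IsMonotonePair.isIntegrableCDF_g {ε : ℝ} {f g : ℝ → ℝ} (h : IsMonotonePair ε f g)
    (hε : 0 < ε) : IsIntegrableCDF g := ⟨h.isCDF_g hε, h.integrable_quantile_g hε⟩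

/-- The probability measure with density `w`. -/
def windowMeasure (w : ℝ → ℝ) : Measure ℝ := volume.withDensity fun x => ENNReal.ofReal (w x)

section Potential

variable {w hf hg f g : ℝ → ℝ}

theorem isProbabilityMeasure_windowMeasure (hw : IsWindow w) :
    IsProbabilityMeasure (windowMeasure w) := by
  refine ⟨?_⟩
  rw [windowMeasure, withDensity_apply _ MeasurableSet.univ, Measure.restrict_univ,
    ← ofReal_integral_eq_lintegral_ofReal hw.integrable (ae_of_all _ hw.nonneg),
    hw.integral_eq_one, ENNReal.ofReal_one]

theorem integral_windowMeasure (hw : IsWindow w) (h : ℝ → ℝ) :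
    ∫ s, h s ∂(windowMeasure w) = ∫ s, h s * w s := by
  rw [windowMeasure, integral_withDensity_eq_integral_toReal_smul₀
    hw.integrable.aestronglyMeasurable.aemeasurable.ennreal_ofReal
    (ae_of_all _ fun _ => ENNReal.ofReal_lt_top)]
  congr 1
  funext s
  rw [ENNReal.toReal_ofReal (hw.nonneg s), smul_eq_mul, mul_comm]

theorem integrable_id_windowMeasure (hw : IsWindow w)
    (hm : Integrable fun x : ℝ => |x| * w x) : Integrable (fun s : ℝ => s) (windowMeasure w) := by
  rw [windowMeasure, integrable_withDensity_iff_integrable_smul₀'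
    hw.integrable.aestronglyMeasurable.aemeasurable.ennreal_ofReal
    (ae_of_all _ fun _ => ENNReal.ofReal_lt_top)]
  refine (integrable_id_mul hw hm).congr (ae_of_all _ fun s => ?_)
  simp only [ENNReal.toReal_ofReal (hw.nonneg s), smul_eq_mul, mul_comm]

/-- The mean of `max(X, Y + S)`. -/
def interaction (w f g : ℝ → ℝ) (z : ℝ × ℝ) : ℝ :=
  quantile g z.1 + windowMax w (quantile f z.2 - quantile g z.1)

theorem integral_max_add (hw : IsWindow w) (hm : Integrable fun x : ℝ => |x| * w x) (a b : ℝ) :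
    ∫ s, max a (b + s) ∂(windowMeasure w) = b + windowMax w (a - b) := by
  have h : ∀ s, max a (b + s) * w s = b * w s + max (a - b) s * w s := fun s => by
    rw [← add_mul, ← max_add_add_left, add_sub_cancel]
  rw [integral_windowMeasure hw]
  simp only [h]
  rw [integral_add (hw.integrable.const_mul b) (integrable_max_mul hw hm _), integral_const_mul,
    hw.integral_eq_one, mul_one, windowMax]

theorem integrable_max_quantile (hw : IsWindow w) (hm : Integrable fun x : ℝ => |x| * w x)
    (hf' : IsIntegrableCDF f) (hg' : IsIntegrableCDF g) :
    Integrable (fun z : (ℝ × ℝ) × ℝ => max (quantile f z.1.2) (quantile g z.1.1 + z.2))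
      (((volume.restrict (Ioo 0 1)).prod (volume.restrict (Ioo 0 1))).prod (windowMeasure w)) := by
  have := isProbabilityMeasure_windowMeasure hw
  have h1 : Integrable (fun z : ℝ × ℝ => quantile f z.2)
    ((volume.restrict (Ioo 0 1)).prod (volume.restrict (Ioo 0 1))) := hf'.integrable.comp_snd _
  have h2 : Integrable (fun z : ℝ × ℝ => quantile g z.1)
    ((volume.restrict (Ioo 0 1)).prod (volume.restrict (Ioo 0 1))) := hg'.integrable.comp_fst _
  exact (h1.comp_fst _).sup ((h2.comp_fst _).add ((integrable_id_windowMeasure hw hm).comp_snd _))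

theorem integrable_interaction (hw : IsWindow w) (hm : Integrable fun x : ℝ => |x| * w x)
    (hf' : IsIntegrableCDF f) (hg' : IsIntegrableCDF g) :
    Integrable (interaction w f g)
      ((volume.restrict (Ioo 0 1)).prod (volume.restrict (Ioo 0 1))) := by
  have := isProbabilityMeasure_windowMeasure hw
  have h := (integrable_max_quantile hw hm hf' hg').integral_prod_left
  simp only [integral_max_add hw hm] at h
  exact h

theorem integral_max_quantile (hw : IsWindow w) (hm : Integrable fun x : ℝ => |x| * w x)
    (hf' : IsIntegrableCDF f) (hg' : IsIntegrableCDF g) :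
    ∫ z : (ℝ × ℝ) × ℝ, max (quantile f z.1.2) (quantile g z.1.1 + z.2)
      ∂((volume.restrict (Ioo 0 1)).prod (volume.restrict (Ioo 0 1))).prod (windowMeasure w) =
    ∫ z, interaction w f g z ∂(volume.restrict (Ioo 0 1)).prod (volume.restrict (Ioo 0 1)) := by
  have := isProbabilityMeasure_windowMeasure hw
  rw [integral_prod _ (integrable_max_quantile hw hm hf' hg')]
  simp only [integral_max_add hw hm]
  rfl

theorem integral_step_max (hw : IsWindow w) (a b x : ℝ) :
    ∫ s, step (max a (b + s)) x ∂(windowMeasure w) =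
      windowCDF w (x - b) * (Ici a).indicator 1 x - (Ici (0 : ℝ)).indicator 1 x := by
  have h : ∀ s, step (max a (b + s)) x * w s =
      (Iic (x - b)).indicator w s * (Ici a).indicator 1 x -
        (Ici (0 : ℝ)).indicator 1 x * w s := fun s => by
    have h1 : s ≤ x - b ↔ b + s ≤ x := ⟨fun h => by linarith, fun h => by linarith⟩
    by_cases h2 : a ≤ x <;> by_cases h3 : b + s ≤ x <;>
      simp [step, indicator, h1, h2, h3, sub_mul]
  rw [integral_windowMeasure hw]
  simp only [h]
  rw [integral_sub ((hw.integrable.indicator measurableSet_Iic).mul_const _)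
    (hw.integrable.const_mul _), integral_mul_const, integral_indicator measurableSet_Iic,
    integral_const_mul, hw.integral_eq_one, mul_one, windowCDF]

theorem IsCDF.integral_step_mul (hg' : IsCDF g) (hhg : IsUpdate hg) {x : ℝ}
    (hx : ContinuousAt g x) :
    ∫ u in Ioo (0 : ℝ) 1, step (quantile g u) x * genInv hg u =
      (∫ u in (0 : ℝ)..g x, genInv hg u) -
        (Ici (0 : ℝ)).indicator 1 x * ∫ u in (0 : ℝ)..1, genInv hg u := by
  have hi : Integrable (genInv hg) (volume.restrict (Ioo 0 1)) :=
    Integrable.of_bound hhg.aemeasurable_genInv.aestronglyMeasurable 1 hhg.genInv_norm_le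
  have hnull : NullMeasurableSet {u | quantile g u ≤ x} (volume.restrict (Ioo (0 : ℝ) 1)) :=
    nullMeasurableSet_le hg'.aemeasurable_quantile aemeasurable_const
  have h : ∀ u, step (quantile g u) x * genInv hg u =
      {u | quantile g u ≤ x}.indicator (genInv hg) u -
        (Ici (0 : ℝ)).indicator 1 x * genInv hg u := fun u => by
    by_cases h2 : quantile g u ≤ x <;> simp [step, indicator, h2, sub_mul]
  simp only [h]
  rw [integral_sub (hi.indicator₀ hnull) (hi.const_mul _),
    hg'.integral_indicator_quantile_le hx, integral_const_mul, ← integral_Ioc_eq_integral_Ioo,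
    ← intervalIntegral.integral_of_le zero_le_one]

/-- By independence, `max(X, Y + S) ≤ x` has probability `f(x) (g ⊗ w)(x)`: this is how the product
term of the potential becomes a mean. -/
theorem ae_integral_step_max (hw : IsWindow w) (hf' : IsCDF f) (hg' : IsCDF g) {x : ℝ}
    (hx : ContinuousAt f x) :
    ∫ z : (ℝ × ℝ) × ℝ, step (max (quantile f z.1.2) (quantile g z.1.1 + z.2)) x
      ∂((volume.restrict (Ioo 0 1)).prod (volume.restrict (Ioo 0 1))).prod (windowMeasure w) =
    f x * smooth w g x - (Ici (0 : ℝ)).indicator 1 x := by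
  have := isProbabilityMeasure_windowMeasure hw
  have hX : AEMeasurable (fun z : ℝ × ℝ => quantile f z.2)
    ((volume.restrict (Ioo 0 1)).prod (volume.restrict (Ioo 0 1))) :=
      hf'.aemeasurable_quantile.comp_snd
  have hY : AEMeasurable (fun z : ℝ × ℝ => quantile g z.1)
    ((volume.restrict (Ioo 0 1)).prod (volume.restrict (Ioo 0 1))) :=
      hg'.aemeasurable_quantile.comp_fst
  have hZ : AEMeasurable (fun z : (ℝ × ℝ) × ℝ => max (quantile f z.1.2) (quantile g z.1.1 + z.2))
      (((volume.restrict (Ioo 0 1)).prod (volume.restrict (Ioo 0 1))).prod (windowMeasure w)) :=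
    hX.comp_fst.max (hY.comp_fst.add measurable_snd.aemeasurable)
  have hnull := nullMeasurableSet_le hZ (aemeasurable_const (b := x))
  have hint : Integrable (fun z : (ℝ × ℝ) × ℝ =>
      step (max (quantile f z.1.2) (quantile g z.1.1 + z.2)) x)
      (((volume.restrict (Ioo 0 1)).prod (volume.restrict (Ioo 0 1))).prod (windowMeasure w)) :=
    Integrable.of_bound (((aestronglyMeasurable_const (b := (1 : ℝ))).indicator₀ hnull).sub
      aestronglyMeasurable_const) 1 (ae_of_all _ fun z => abs_step_le _ _)
  rw [integral_prod _ hint]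
  simp only [integral_step_max hw]
  have hnull' : NullMeasurableSet {v | quantile f v ≤ x} (volume.restrict (Ioo (0 : ℝ) 1)) :=
    nullMeasurableSet_le hf'.aemeasurable_quantile aemeasurable_const
  have hind : Integrable (fun v => (Ici (quantile f v)).indicator (1 : ℝ → ℝ) x)
      (volume.restrict (Ioo (0 : ℝ) 1)) := (integrable_const (1 : ℝ)).indicator₀ hnull'
  have key := hf'.integral_indicator_quantile_le hx 1
  simp only [Pi.one_apply, intervalIntegral.integral_const, sub_zero, smul_eq_mul, mul_one] at key
  have key' : ∫ v in Ioo (0 : ℝ) 1, (Ici (quantile f v)).indicator (1 : ℝ → ℝ) x = f x := key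
  rw [integral_sub ((integrable_windowCDF_sub_quantile hw hg' x).mul_prod hind)
    (integrable_const _), integral_prod_mul
      (fun u => windowCDF w (x - quantile g u))
      (fun v => (Ici (quantile f v)).indicator (1 : ℝ → ℝ) x), key', ← smooth_eq hw hg', mul_comm]
  simp

/-- The corrections by the step at `0` cancel exactly because `∫₀¹ h_g⁻¹ + ∫₀¹ h_f⁻¹ = 1`, which is
the condition `A(1) = 0`. -/
theorem ae_potentialDensity_eq (hw : IsWindow w) (hhf : IsUpdate hf) (hhg : IsUpdate hg)
    (h1 : area hf hg 1 = 0) (hf' : IsCDF f) (hg' : IsCDF g) :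
    ∀ᵐ x : ℝ, ((∫ u in Ioo (0 : ℝ) 1, step (quantile g u) x * genInv hg u) +
        ∫ v in Ioo (0 : ℝ) 1, step (quantile f v) x * genInv hf v) -
      ∫ z : (ℝ × ℝ) × ℝ, step (max (quantile f z.1.2) (quantile g z.1.1 + z.2)) x * 1
        ∂((volume.restrict (Ioo 0 1)).prod (volume.restrict (Ioo 0 1))).prod (windowMeasure w) =
      potentialDensity w hf hg f g x := by
  filter_upwards [hf'.ae_continuousAt, hg'.ae_continuousAt] with x hxf hxg
  simp only [mul_one]
  rw [hg'.integral_step_mul hhg hxg, hf'.integral_step_mul hhf hxf,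
    ae_integral_step_max hw hf' hg' hxf, potentialDensity]
  have := integral_genInv_add hhf hhg h1
  linear_combination (-(Ici (0 : ℝ)).indicator 1 x) * this

theorem integrable_and_integral_potentialDensity (hw : IsWindow w) (hhf : IsUpdate hf)
    (hhg : IsUpdate hg) (h1 : area hf hg 1 = 0) (hm : Integrable fun x : ℝ => |x| * w x)
    (hf' : IsIntegrableCDF f) (hg' : IsIntegrableCDF g) :
    Integrable (potentialDensity w hf hg f g) ∧
    potential w hf hg f g =
      (∫ z, interaction w f g z ∂(volume.restrict (Ioo 0 1)).prod (volume.restrict (Ioo 0 1))) -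
      (∫ u in Ioo (0 : ℝ) 1, quantile g u * genInv hg u) -
      ∫ v in Ioo (0 : ℝ) 1, quantile f v * genInv hf v := by
  have := isProbabilityMeasure_windowMeasure hw
  have hae := ae_potentialDensity_eq hw hhf hhg h1 hf'.toIsCDF hg'.toIsCDF
  have mg := hhg.aemeasurable_genInv.aestronglyMeasurable
  have mf := hhf.aemeasurable_genInv.aestronglyMeasurable
  have hZ := integrable_max_quantile hw hm hf' hg'
  have hone : ∀ᵐ _z : (ℝ × ℝ) × ℝ ∂((volume.restrict (Ioo (0 : ℝ) 1)).prod
      (volume.restrict (Ioo (0 : ℝ) 1))).prod (windowMeasure w), ‖(1 : ℝ)‖ ≤ 1 := by simp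
  have ig := integrable_integral_step_mul hg'.integrable mg hhg.genInv_norm_le
  have if' := integrable_integral_step_mul hf'.integrable mf hhf.genInv_norm_le
  have iZ := integrable_integral_step_mul hZ aestronglyMeasurable_const hone
  have igf : Integrable fun x => (∫ u in Ioo (0 : ℝ) 1, step (quantile g u) x * genInv hg u) +
    ∫ v in Ioo (0 : ℝ) 1, step (quantile f v) x * genInv hf v := ig.add if'
  refine ⟨(igf.sub iZ).congr hae, ?_⟩
  rw [potential, ← integral_congr_ae hae, integral_sub igf iZ, integral_add ig if',
    integral_integral_step_mul hg'.integrable mg hhg.genInv_norm_le,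
    integral_integral_step_mul hf'.integrable mf hhf.genInv_norm_le,
    integral_integral_step_mul hZ aestronglyMeasurable_const hone]
  simp only [mul_one]
  rw [integral_max_quantile hw hm hf' hg']
  ring

end Potential

/-! ### Displacement interpolation -/

section Interpolation

variable {p₀ p₁ : ℝ → ℝ} {l : ℝ}

/-- The set measured by `dispInterp` is an initial segment of levels, closed at interior levels by
left-continuity of the quantiles; hence the equivalence holds at every `x`, jumps included. -/
theorem le_dispInterp_iff (h₀ : IsCDF p₀) (h₁ : IsCDF p₁) (hl : l ∈ Ioo (0 : ℝ) 1) {u x : ℝ}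
    (hu : u ∈ Ioo (0 : ℝ) 1) :
    u ≤ dispInterp l p₀ p₁ x ↔ (1 - l) * quantile p₀ u + l * quantile p₁ u ≤ x := by
  have hmono : ∀ s ∈ Ioo (0 : ℝ) 1, ∀ t ∈ Ioo (0 : ℝ) 1, s ≤ t →
      (1 - l) * quantile p₀ s + l * quantile p₁ s ≤
        (1 - l) * quantile p₀ t + l * quantile p₁ t := fun s hs t ht hst =>
    add_le_add (mul_le_mul_of_nonneg_left (h₀.quantile_monotoneOn hs ht hst)
      (sub_nonneg.2 hl.2.le)) (mul_le_mul_of_nonneg_left (h₁.quantile_monotoneOn hs ht hst) hl.1.le)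
  constructor
  · intro h
    have hlim : Tendsto (fun t => (1 - l) * quantile p₀ t + l * quantile p₁ t) (𝓝[<] u)
        (𝓝 ((1 - l) * quantile p₀ u + l * quantile p₁ u)) :=
      ((h₀.tendsto_quantile hu).const_mul _).add ((h₁.tendsto_quantile hu).const_mul _)
    refine le_of_tendsto hlim ?_
    filter_upwards [Ioo_mem_nhdsLT hu.1] with t ht
    have ht1 : t ∈ Ioo (0 : ℝ) 1 := ⟨ht.1, ht.2.trans hu.2⟩
    by_contra hlt
    have hsub : {u | u ∈ Ioo (0 : ℝ) 1 ∧ (1 - l) * quantile p₀ u + l * quantile p₁ u ≤ x} ⊆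
        Ioc 0 t := by
      intro s hs
      refine ⟨hs.1.1, ?_⟩
      by_contra hc
      exact hlt ((hmono t ht1 s hs.1 (not_le.mp hc).le).trans hs.2)
    have hle := measureReal_mono (μ := volume) hsub (by simp)
    rw [Real.volume_real_Ioc_of_le ht.1.le, sub_zero] at hle
    exact absurd (h.trans hle) (not_le.mpr ht.2)
  · intro h
    have hsub : Ioc 0 u ⊆
        {u | u ∈ Ioo (0 : ℝ) 1 ∧ (1 - l) * quantile p₀ u + l * quantile p₁ u ≤ x} := fun s hs =>
      ⟨⟨hs.1, hs.2.trans_lt hu.2⟩, (hmono s ⟨hs.1, hs.2.trans_lt hu.2⟩ u hu hs.2).trans h⟩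
    have hfin : volume {u | u ∈ Ioo (0 : ℝ) 1 ∧
        (1 - l) * quantile p₀ u + l * quantile p₁ u ≤ x} ≠ ⊤ :=
      measure_ne_top_of_subset (fun s hs => hs.1) (by simp : volume (Ioo (0 : ℝ) 1) ≠ ⊤)
    have hle := measureReal_mono (μ := volume) hsub hfin
    rwa [Real.volume_real_Ioc_of_le hu.1.le, sub_zero] at hle

theorem dispInterp_mem_Icc (l : ℝ) (p₀ p₁ : ℝ → ℝ) (x : ℝ) :
    dispInterp l p₀ p₁ x ∈ Icc (0 : ℝ) 1 := by
  refine ⟨measureReal_nonneg, ?_⟩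
  have hsub : {u | u ∈ Ioo (0 : ℝ) 1 ∧ (1 - l) * quantile p₀ u + l * quantile p₁ u ≤ x} ⊆
      Ioo 0 1 := fun s hs => hs.1
  have h := measureReal_mono (μ := volume) hsub (by simp)
  rw [Real.volume_real_Ioo_of_le zero_le_one, sub_zero] at h
  exact h

theorem isCDF_dispInterp (h₀ : IsCDF p₀) (h₁ : IsCDF p₁) (hl : l ∈ Ioo (0 : ℝ) 1) :
    IsCDF (dispInterp l p₀ p₁) := by
  refine ⟨fun x y hxy => ?_, ?_, ?_⟩
  · refine measureReal_mono (fun u hu => ⟨hu.1, hu.2.trans hxy⟩) ?_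
    exact measure_ne_top_of_subset (fun s hs => hs.1) (by simp : volume (Ioo (0 : ℝ) 1) ≠ ⊤)
  · rw [tendsto_order]
    refine ⟨fun a ha => Eventually.of_forall fun x =>
      ha.trans_le (dispInterp_mem_Icc l p₀ p₁ x).1, fun a ha => ?_⟩
    obtain ⟨u, hu0, hu1⟩ := exists_between (lt_min ha one_pos)
    have hu : u ∈ Ioo (0 : ℝ) 1 := ⟨hu0, hu1.trans_le (min_le_right _ _)⟩
    filter_upwards [eventually_lt_atBot ((1 - l) * quantile p₀ u + l * quantile p₁ u)] with x hx
    refine lt_of_not_ge fun hc => ?_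
    have hc' : u ≤ dispInterp l p₀ p₁ x := (hu1.trans_le (min_le_left _ _)).le.trans hc
    exact absurd ((le_dispInterp_iff h₀ h₁ hl hu).1 hc') (not_le.mpr hx)
  · rw [tendsto_order]
    refine ⟨fun a ha => ?_, fun a ha => Eventually.of_forall fun x =>
      (dispInterp_mem_Icc l p₀ p₁ x).2.trans_lt ha⟩
    obtain ⟨u, hu0, hu1⟩ := exists_between (max_lt ha one_pos)
    have hu : u ∈ Ioo (0 : ℝ) 1 := ⟨(le_max_right _ _).trans_lt hu0, hu1⟩
    filter_upwards [eventually_ge_atTop ((1 - l) * quantile p₀ u + l * quantile p₁ u)] with x hx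
    exact ((le_max_left _ _).trans_lt hu0).trans_le ((le_dispInterp_iff h₀ h₁ hl hu).2 hx)

theorem quantile_dispInterp (h₀ : IsCDF p₀) (h₁ : IsCDF p₁) (hl : l ∈ Ioo (0 : ℝ) 1) {u : ℝ}
    (hu : u ∈ Ioo (0 : ℝ) 1) :
    quantile (dispInterp l p₀ p₁) u = (1 - l) * quantile p₀ u + l * quantile p₁ u := by
  have h : {x | u ≤ dispInterp l p₀ p₁ x} =
      Ici ((1 - l) * quantile p₀ u + l * quantile p₁ u) := by
    ext x
    exact le_dispInterp_iff h₀ h₁ hl hu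
  rw [quantile, h, csInf_Ici]

/-- Integrability of the quantile is all the formula for the potential requires, so the tail rate of
the interpolant need not be tracked. -/
theorem isIntegrableCDF_dispInterp (h₀ : IsIntegrableCDF p₀) (h₁ : IsIntegrableCDF p₁)
    (hl : l ∈ Ioo (0 : ℝ) 1) : IsIntegrableCDF (dispInterp l p₀ p₁) := by
  refine ⟨isCDF_dispInterp h₀.toIsCDF h₁.toIsCDF hl, ?_⟩
  refine ((h₀.integrable.const_mul (1 - l)).add (h₁.integrable.const_mul l)).congr ?_
  filter_upwards [ae_restrict_mem measurableSet_Ioo] with u hu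
  exact (quantile_dispInterp h₀.toIsCDF h₁.toIsCDF hl hu).symm

end Interpolation

/-! ### Displacement convexity, minimality of fixed points, and symmetry of the potential. -/

section Convexity

variable {w hf hg f g f₀ g₀ f₁ g₁ : ℝ → ℝ}

theorem IsIntegrableCDF.integrable_mul_genInv {p h : ℝ → ℝ} (hp : IsIntegrableCDF p)
    (hh : IsUpdate h) :
    Integrable (fun u => quantile p u * genInv h u) (volume.restrict (Ioo 0 1)) :=
  hp.integrable.mul_bdd hh.aemeasurable_genInv.aestronglyMeasurable hh.genInv_norm_le

theorem integral_dispInterp_mul_genInv {p₀ p₁ h : ℝ → ℝ} (h₀ : IsIntegrableCDF p₀)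
    (h₁ : IsIntegrableCDF p₁) (hh : IsUpdate h) {l : ℝ} (hl : l ∈ Ioo (0 : ℝ) 1) :
    ∫ u in Ioo (0 : ℝ) 1, quantile (dispInterp l p₀ p₁) u * genInv h u =
      (1 - l) * (∫ u in Ioo (0 : ℝ) 1, quantile p₀ u * genInv h u) +
        l * ∫ u in Ioo (0 : ℝ) 1, quantile p₁ u * genInv h u := by
  rw [← integral_const_mul, ← integral_const_mul,
    ← integral_add ((h₀.integrable_mul_genInv hh).const_mul _)
      ((h₁.integrable_mul_genInv hh).const_mul _)]
  refine setIntegral_congr_fun measurableSet_Ioo fun u hu => ?_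
  simp only [quantile_dispInterp h₀.toIsCDF h₁.toIsCDF hl hu]
  ring

/-- If displacement convexity is not strict, the window masses agree almost everywhere. -/
theorem ae_windowCDF_eq_of_potential_le (hw : IsWindow w) (hhf : IsUpdate hf)
    (hhg : IsUpdate hg) (ha : area hf hg 1 = 0) (hm : Integrable fun x : ℝ => |x| * w x)
    (hf₀ : IsIntegrableCDF f₀) (hg₀ : IsIntegrableCDF g₀) (hf₁ : IsIntegrableCDF f₁)
    (hg₁ : IsIntegrableCDF g₁) {l : ℝ} (hl : l ∈ Ioo (0 : ℝ) 1)
    (hle : (1 - l) * potential w hf hg f₀ g₀ + l * potential w hf hg f₁ g₁ ≤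
      potential w hf hg (dispInterp l f₀ f₁) (dispInterp l g₀ g₁)) :
    ∀ᵐ z : ℝ × ℝ ∂(volume.restrict (Ioo 0 1)).prod (volume.restrict (Ioo 0 1)),
      windowCDF w (quantile g₀ z.1 - quantile f₀ z.2) =
        windowCDF w (quantile g₁ z.1 - quantile f₁ z.2) := by
  let μ : Measure (ℝ × ℝ) := (volume.restrict (Ioo 0 1)).prod (volume.restrict (Ioo 0 1))
  have hfl := isIntegrableCDF_dispInterp hf₀ hf₁ hl
  have hgl := isIntegrableCDF_dispInterp hg₀ hg₁ hl
  rw [(integrable_and_integral_potentialDensity hw hhf hhg ha hm hf₀ hg₀).2,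
    (integrable_and_integral_potentialDensity hw hhf hhg ha hm hf₁ hg₁).2,
    (integrable_and_integral_potentialDensity hw hhf hhg ha hm hfl hgl).2,
    integral_dispInterp_mul_genInv hf₀ hf₁ hhf hl, integral_dispInterp_mul_genInv hg₀ hg₁ hhg hl]
    at hle
  have i0 := integrable_interaction hw hm hf₀ hg₀
  have i1 := integrable_interaction hw hm hf₁ hg₁
  have il := integrable_interaction hw hm hfl hgl
  have ic : Integrable (fun z => (1 - l) * interaction w f₀ g₀ z + l * interaction w f₁ g₁ z) μ :=
    (i0.const_mul _).add (i1.const_mul _)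
  have hmem : ∀ᵐ z ∂μ, z.1 ∈ Ioo (0 : ℝ) 1 ∧ z.2 ∈ Ioo (0 : ℝ) 1 :=
    (Measure.quasiMeasurePreserving_fst.ae (ae_restrict_mem measurableSet_Ioo)).and
      (Measure.quasiMeasurePreserving_snd.ae (ae_restrict_mem measurableSet_Ioo))
  have hform : ∀ z : ℝ × ℝ, z.1 ∈ Ioo (0 : ℝ) 1 → z.2 ∈ Ioo (0 : ℝ) 1 →
      interaction w (dispInterp l f₀ f₁) (dispInterp l g₀ g₁) z =
        ((1 - l) * quantile g₀ z.1 + l * quantile g₁ z.1) +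
          windowMax w ((1 - l) * (quantile f₀ z.2 - quantile g₀ z.1) +
            l * (quantile f₁ z.2 - quantile g₁ z.1)) := by
    intro z h1 h2
    rw [interaction, quantile_dispInterp hf₀.toIsCDF hf₁.toIsCDF hl h2,
      quantile_dispInterp hg₀.toIsCDF hg₁.toIsCDF hl h1]
    congr 2
    ring
  have hpt : interaction w (dispInterp l f₀ f₁) (dispInterp l g₀ g₁) ≤ᵐ[μ]
      fun z => (1 - l) * interaction w f₀ g₀ z + l * interaction w f₁ g₁ z := by
    filter_upwards [hmem] with z hz
    have := windowMax_convex hw hm hl (quantile f₀ z.2 - quantile g₀ z.1)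
      (quantile f₁ z.2 - quantile g₁ z.1)
    rw [hform z hz.1 hz.2, interaction, interaction]
    linarith
  have heq : ∫ z, interaction w (dispInterp l f₀ f₁) (dispInterp l g₀ g₁) z ∂μ =
      ∫ z, ((1 - l) * interaction w f₀ g₀ z + l * interaction w f₁ g₁ z) ∂μ := by
    refine le_antisymm (integral_mono_ae il ic hpt) ?_
    rw [integral_add (i0.const_mul _) (i1.const_mul _), integral_const_mul, integral_const_mul]
    linarith
  filter_upwards [(integral_eq_iff_of_ae_le il ic hpt).1 heq, hmem] with z hz hz'
  rw [hform z hz'.1 hz'.2, interaction, interaction] at hz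
  have := windowCDF_eq_of_windowMax_convex hw hm hl (a := quantile f₀ z.2 - quantile g₀ z.1)
    (b := quantile f₁ z.2 - quantile g₁ z.1) (by linarith)
  rw [← neg_sub, windowCDF_neg hw, this, ← windowCDF_neg hw, neg_sub]

/-- A weak fixed point minimizes the potential. -/
theorem IsWeakFixedPoint.potential_le (hw : IsWindow w) (hhf : IsUpdate hf)
    (hhg : IsUpdate hg) (ha : area hf hg 1 = 0) (hm : Integrable fun x : ℝ => |x| * w x)
    (hf₀ : IsIntegrableCDF f₀) (hg₀ : IsIntegrableCDF g₀) (hf₁ : IsIntegrableCDF f₁)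
    (hg₁ : IsIntegrableCDF g₁) (h : IsWeakFixedPoint w hf hg f₀ g₀) :
    potential w hf hg f₀ g₀ ≤ potential w hf hg f₁ g₁ := by
  let μ : Measure (ℝ × ℝ) := (volume.restrict (Ioo 0 1)).prod (volume.restrict (Ioo 0 1))
  let b : ℝ × ℝ → ℝ := fun z => windowCDF w (quantile g₀ z.1 - quantile f₀ z.2)
  let dg : ℝ → ℝ := fun u => quantile g₁ u - quantile g₀ u
  let df : ℝ → ℝ := fun v => quantile f₁ v - quantile f₀ v
  have hdg : Integrable dg (volume.restrict (Ioo 0 1)) := hg₁.integrable.sub hg₀.integrable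
  have hdf : Integrable df (volume.restrict (Ioo 0 1)) := hf₁.integrable.sub hf₀.integrable
  have ig : Integrable (fun z => b z * dg z.1) μ :=
    integrable_windowCDF_mul hw hf₀.toIsCDF hg₀.toIsCDF (hdg.comp_fst _)
  have if' : Integrable (fun z => b z * df z.2) μ :=
    integrable_windowCDF_mul hw hf₀.toIsCDF hg₀.toIsCDF (hdf.comp_snd _)
  have idf : Integrable (fun z : ℝ × ℝ => df z.2) μ := hdf.comp_snd _
  have i0 := integrable_interaction hw hm hf₀ hg₀
  have i1 := integrable_interaction hw hm hf₁ hg₁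
  -- The subgradient inequality at the fixed point has slope `1 - b`; integrated against the
  -- marginals, its left side is exactly the change of the two linear terms.
  have hpt : ∀ z, b z * dg z.1 + (df z.2 - b z * df z.2) ≤
      interaction w f₁ g₁ z - interaction w f₀ g₀ z := by
    intro z
    have h1 := windowMax_subgradient hw hm (quantile f₀ z.2 - quantile g₀ z.1)
      (quantile f₁ z.2 - quantile g₁ z.1)
    rw [← neg_sub (quantile g₀ z.1), windowCDF_neg hw, neg_sub] at h1
    simp only [b, dg, df, interaction]
    linarith
  have ifd : Integrable (fun z => df z.2 - b z * df z.2) μ := idf.sub if'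
  have hmono := integral_mono (ig.add ifd) (i1.sub i0) hpt
  have e1 : ∫ z, b z * dg z.1 + (df z.2 - b z * df z.2) ∂μ =
      (∫ u in Ioo (0 : ℝ) 1, genInv hg u * dg u) + ∫ v in Ioo (0 : ℝ) 1, genInv hf v * df v := by
    have e2 : ∫ z : ℝ × ℝ, df z.2 ∂μ = ∫ v in Ioo (0 : ℝ) 1, df v := by
      rw [integral_fun_snd]
      simp
    have e3 : ∫ v in Ioo (0 : ℝ) 1, (1 - genInv hf v) * df v =
        (∫ v in Ioo (0 : ℝ) 1, df v) - ∫ v in Ioo (0 : ℝ) 1, genInv hf v * df v := by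
      rw [← integral_sub hdf
        (hdf.bdd_mul hhf.aemeasurable_genInv.aestronglyMeasurable hhf.genInv_norm_le)]
      congr 1
      funext v
      ring
    rw [integral_add ig ifd, integral_sub idf if',
      h.integral_mul_fst hw hf₀.toIsCDF hg₀.toIsCDF hdg,
      h.integral_mul_snd hw hf₀.toIsCDF hg₀.toIsCDF hdf, e2, e3]
    ring
  have e4 : ∀ {p₀ p₁ k : ℝ → ℝ}, IsIntegrableCDF p₀ → IsIntegrableCDF p₁ → IsUpdate k →
      ∫ u in Ioo (0 : ℝ) 1, genInv k u * (quantile p₁ u - quantile p₀ u) =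
        (∫ u in Ioo (0 : ℝ) 1, quantile p₁ u * genInv k u) -
          ∫ u in Ioo (0 : ℝ) 1, quantile p₀ u * genInv k u := by
    intro p₀ p₁ k h₀ h₁ hk
    rw [← integral_sub (h₁.integrable_mul_genInv hk) (h₀.integrable_mul_genInv hk)]
    congr 1
    funext u
    ring
  simp only [Pi.add_apply, Pi.sub_apply] at hmono
  rw [e1, integral_sub i1 i0, e4 hg₀ hg₁ hhg, e4 hf₀ hf₁ hhf] at hmono
  rw [(integrable_and_integral_potentialDensity hw hhf hhg ha hm hf₀ hg₀).2,
    (integrable_and_integral_potentialDensity hw hhf hhg ha hm hf₁ hg₁).2]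
  linarith

theorem area_one_swap (hhf : IsUpdate hf) (hhg : IsUpdate hg) (ha : area hf hg 1 = 0) :
    area hg hf 1 = 0 := by
  have h := integral_genInv_add hhf hhg ha
  rw [hhg.integral_genInv_one] at h
  rw [area_eq hhg hhf (right_mem_Icc.2 zero_le_one)]
  linarith

/-- The potential is symmetric under exchange of the two components. -/
theorem potential_swap (hw : IsWindow w) (hhf : IsUpdate hf) (hhg : IsUpdate hg)
    (ha : area hf hg 1 = 0) (hm : Integrable fun x : ℝ => |x| * w x)
    (hf' : IsIntegrableCDF f) (hg' : IsIntegrableCDF g) :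
    potential w hf hg f g = potential w hg hf g f := by
  rw [(integrable_and_integral_potentialDensity hw hhf hhg ha hm hf' hg').2,
    (integrable_and_integral_potentialDensity hw hhg hhf (area_one_swap hhf hhg ha) hm hg' hf').2,
    ← integral_prod_swap (interaction w f g)]
  have h : ∀ z : ℝ × ℝ, interaction w f g z.swap = interaction w g f z := fun z => by
    rw [interaction, interaction, ← neg_sub (quantile f z.1), windowMax_neg hw hm]
    simp only [Prod.fst_swap, Prod.snd_swap]
    ring
  simp only [h]
  ring

end Convexity

/-! ### Minimizers are weak fixed points -/

/-- Replacement of `f` on `[-R, R]` by the truncation of `h_f (g ⊗ w)` to `[f(-R), f(R)]`. -/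
def updateOn (w hf f g : ℝ → ℝ) (R x : ℝ) : ℝ :=
  open Classical in
  if x ∈ Icc (-R) R then max (f (-R)) (min (f R) (hf (smooth w g x))) else f x

section Minimizer

variable {w hf hg f g : ℝ → ℝ}

theorem updateOn_mono (hw : IsWindow w) (hhf : IsUpdate hf) (hf' : Monotone f) (hg' : IsCDF g)
    (R : ℝ) : Monotone (updateOn w hf f g R) := by
  intro x y hxy
  simp only [updateOn]
  split_ifs with hx hy hy
  · exact max_le_max le_rfl (min_le_min le_rfl (hhf.monotoneOn (smooth_mem_Icc hw hg' x)
      (smooth_mem_Icc hw hg' y) (smooth_mono hw hg' hxy)))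
  · have hR : R ≤ y := by
      by_contra hc
      exact hy ⟨hx.1.trans hxy, (not_le.mp hc).le⟩
    exact max_le (hf' ((hx.1.trans hx.2).trans hR)) ((min_le_left _ _).trans (hf' hR))
  · have hR : x ≤ -R := by
      by_contra hc
      exact hx ⟨(not_le.mp hc).le, hxy.trans hy.2⟩
    exact (hf' hR).trans (le_max_left _ _)
  · exact hf' hxy

/-- The change is confined to a bounded interval, which preserves the tails, and the truncation
keeps the result monotone across `±R`. -/
theorem updateOn_isMonotonePair (hw : IsWindow w) (hhf : IsUpdate hf) {ε : ℝ} (hε : 0 < ε)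
    (h : IsMonotonePair ε f g) (R : ℝ) : IsMonotonePair ε (updateOn w hf f g R) g := by
  refine ⟨⟨fun x => ?_, h.mem_f.2.1.congr' ?_, h.mem_f.2.2.congr' ?_⟩, h.mem_g,
    updateOn_mono hw hhf h.mono_f (h.isCDF_g hε) R, h.mono_g⟩
  · simp only [updateOn]
    split_ifs with hx
    · exact ⟨(h.mem_f.1 (-R)).1.trans (le_max_left _ _),
        max_le (h.mem_f.1 (-R)).2 ((min_le_left _ _).trans (h.mem_f.1 R).2)⟩
    · exact h.mem_f.1 x
  · filter_upwards [eventually_lt_atBot (-R)] with x hx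
    rw [updateOn, if_neg fun hx' => absurd hx'.1 (not_le.mpr hx)]
  · filter_upwards [eventually_gt_atTop R] with x hx
    rw [updateOn, if_neg fun hx' => absurd hx'.2 (not_le.mpr hx)]

/-- The `f`-component of a minimizer minimizes the density pointwise. -/
theorem IsMinimizer.ae_pointwise (hw : IsWindow w) (hhf : IsUpdate hf) (hhg : IsUpdate hg)
    (ha : area hf hg 1 = 0) (hm : Integrable fun x : ℝ => |x| * w x) {ε : ℝ} (hε : 0 < ε)
    (h : IsMinimizer ε w hf hg f g) :
    ∀ᵐ x : ℝ, ∀ n : ℕ, x ∈ Icc (-(n : ℝ)) n → ∀ v ∈ Icc (f (-n)) (f n),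
      (∫ t in (0 : ℝ)..f x, genInv hf t) - f x * smooth w g x ≤
        (∫ t in (0 : ℝ)..v, genInv hf t) - v * smooth w g x := by
  rw [ae_all_iff]
  intro n
  have hp := updateOn_isMonotonePair hw hhf hε h.1 n
  have i0 := (integrable_and_integral_potentialDensity hw hhf hhg ha hm
    (h.1.isIntegrableCDF_f hε) (h.1.isIntegrableCDF_g hε)).1
  have i1 := (integrable_and_integral_potentialDensity hw hhf hhg ha hm
    (hp.isIntegrableCDF_f hε) (hp.isIntegrableCDF_g hε)).1
  have hclamp : ∀ x ∈ Icc (-(n : ℝ)) n, ∀ v ∈ Icc (f (-n)) (f n),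
      (∫ t in (0 : ℝ)..updateOn w hf f g n x, genInv hf t) -
        updateOn w hf f g n x * smooth w g x ≤
      (∫ t in (0 : ℝ)..v, genInv hf t) - v * smooth w g x := by
    intro x hx v hv
    rw [updateOn, if_pos hx]
    exact hhf.clamp_isMinOn (smooth_mem_Icc hw (h.1.isCDF_g hε) x) (h.1.mem_f.1 n).2 hv
  have hle : potentialDensity w hf hg (updateOn w hf f g n) g ≤ᵐ[volume]
      potentialDensity w hf hg f g := by
    refine ae_of_all _ fun x => ?_
    by_cases hx : x ∈ Icc (-(n : ℝ)) n
    · have := hclamp x hx (f x) ⟨h.1.mono_f hx.1, h.1.mono_f hx.2⟩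
      simp only [potentialDensity]
      linarith
    · have : updateOn w hf f g n x = f x := by
        rw [updateOn, if_neg hx]
      simp only [potentialDensity, this, le_refl]
  -- The truncated update is nowhere worse, and minimality forbids a smaller integral, so the two
  -- densities agree almost everywhere.
  have heq := (integral_eq_iff_of_ae_le i1 i0 hle).1
    (le_antisymm (integral_mono_ae i1 i0 hle) (h.2 _ _ hp))
  filter_upwards [heq] with x hx hxn v hv
  have h1 := hclamp x hxn v hv
  simp only [potentialDensity] at hx
  linarith

/-- This is the first-order condition of the pointwise minimization of `v ↦ ∫₀ᵛ h_f⁻¹ - v (g ⊗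
w)(x)`, transported to the quantile by taking generic `x` on either side of it. -/
theorem IsMinimizer.genInv_eq (hw : IsWindow w) (hhf : IsUpdate hf) (hhg : IsUpdate hg)
    (ha : area hf hg 1 = 0) (hm : Integrable fun x : ℝ => |x| * w x) {ε : ℝ} (hε : 0 < ε)
    (h : IsMinimizer ε w hf hg f g) {v : ℝ} (hv : v ∈ Ioo (0 : ℝ) 1) :
    genInv hf v = smooth w g (quantile f v) := by
  have hcf := h.1.isCDF_f hε
  have hcg := h.1.isCDF_g hε
  -- Since `f` tends to `0` and `1`, every interior `t` lies in `[f(-n), f(n)]` for large `n`, so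
  -- the truncation disappears.
  have hmin : ∀ᵐ x : ℝ, ∀ t ∈ Ioo (0 : ℝ) 1,
      (∫ s in (0 : ℝ)..f x, genInv hf s) - f x * smooth w g x ≤
        (∫ s in (0 : ℝ)..t, genInv hf s) - t * smooth w g x := by
    filter_upwards [h.ae_pointwise hw hhf hhg ha hm hε] with x hx t ht
    have e1 : ∀ᶠ n : ℕ in atTop, f (-(n : ℝ)) < t :=
      (hcf.bot.comp (tendsto_neg_atTop_atBot.comp tendsto_natCast_atTop_atTop)).eventually
        (gt_mem_nhds ht.1)
    have e2 : ∀ᶠ n : ℕ in atTop, t < f n :=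
      (hcf.top.comp tendsto_natCast_atTop_atTop).eventually (lt_mem_nhds ht.2)
    have e3 : ∀ᶠ n : ℕ in atTop, |x| ≤ n :=
      tendsto_natCast_atTop_atTop.eventually (eventually_ge_atTop |x|)
    obtain ⟨n, ⟨h1, h2⟩, h3⟩ := ((e1.and e2).and e3).exists
    exact hx n (abs_le.1 h3) t ⟨h1.le, h2.le⟩
  have hii : ∀ a b : ℝ, a ≤ 1 → b ≤ 1 → (∫ s in (0 : ℝ)..b, genInv hf s) -
      ∫ s in (0 : ℝ)..a, genInv hf s = ∫ s in a..b, genInv hf s := fun a b ha hb =>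
    intervalIntegral.integral_interval_sub_left (hhf.genInv_intervalIntegrable zero_le_one hb)
      (hhf.genInv_intervalIntegrable zero_le_one ha)
  have hconst : ∀ a b c : ℝ, ∫ _s in a..b, c = (b - a) * c := fun a b c => by simp
  have hcont := (smooth_continuous hw hcg).tendsto (quantile f v)
  have hfreq : ∀ s : Set ℝ, IsOpen s → s.Nonempty → ∃ x ∈ s, ∀ t ∈ Ioo (0 : ℝ) 1,
      (∫ s in (0 : ℝ)..f x, genInv hf s) - f x * smooth w g x ≤
        (∫ s in (0 : ℝ)..t, genInv hf s) - t * smooth w g x := by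
    intro s hs hne
    obtain ⟨x, hx⟩ := ((frequently_ae_mem_iff.2 (hs.measure_pos volume hne).ne').and_eventually
      hmin).exists
    exact ⟨x, hx⟩
  have hmono := smooth_mono hw hcg
  apply le_antisymm
  · refine hhf.genInv_le_of_forall_lt ⟨hv.1, hv.2.le⟩ (smooth_mem_Icc hw hcg _).1 fun t ht => ?_
    refine ge_of_tendsto (hcont.mono_left (nhdsWithin_le_nhds (s := Ioi (quantile f v)))) ?_
    filter_upwards [self_mem_nhdsWithin] with y hy
    -- At such an `x` one has `t < v ≤ f x`; minimality against the competitor `t` bounds the mean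
    -- of the inverse over `[t, f x]`, hence its value at `t`.
    obtain ⟨x, hx, hxt⟩ := hfreq (Ioo (quantile f v) y) isOpen_Ioo (nonempty_Ioo.2 hy)
    have hvx : v ≤ f x := hcf.le_of_quantile_lt hv.2 hx.1
    have htx : t < f x := ht.2.trans_le hvx
    have ht1 : t ≤ 1 := (ht.2.trans hv.2).le
    have key := hxt t ⟨ht.1, ht.2.trans hv.2⟩
    have h1 : ∫ _s in t..f x, genInv hf t ≤ ∫ s in t..f x, genInv hf s :=
      intervalIntegral.integral_mono_on htx.le (by simp)
        (hhf.genInv_intervalIntegrable ht1 (hcf.le_one x)) fun s hs =>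
          hhf.genInv_monotoneOn ht1 (hs.2.trans (hcf.le_one x)) hs.1
    rw [hconst, ← hii t (f x) ht1 (hcf.le_one x)] at h1
    have h2 : (f x - t) * genInv hf t ≤ (f x - t) * smooth w g x := by linarith
    exact (le_of_mul_le_mul_left h2 (sub_pos.2 htx)).trans (hmono hx.2.le)
  · refine le_of_tendsto (hcont.mono_left (nhdsWithin_le_nhds (s := Iio (quantile f v)))) ?_
    filter_upwards [self_mem_nhdsWithin] with y hy
    obtain ⟨x, hx, hxt⟩ := hfreq (Ioo y (quantile f v)) isOpen_Ioo (nonempty_Ioo.2 hy)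
    have hxv : f x < v := hcf.lt_of_lt_quantile hv.1 hx.2
    have key := hxt v hv
    have h1 : ∫ s in f x..v, genInv hf s ≤ ∫ _s in f x..v, genInv hf v :=
      intervalIntegral.integral_mono_on hxv.le
        (hhf.genInv_intervalIntegrable (hcf.le_one x) hv.2.le) (by simp) fun s hs =>
          hhf.genInv_monotoneOn (hs.2.trans hv.2.le) hv.2.le hs.2
    rw [hconst, ← hii (f x) v (hcf.le_one x) hv.2.le] at h1
    have h2 : (v - f x) * smooth w g x ≤ (v - f x) * genInv hf v := by linarith
    exact (hmono hx.1.le).trans (le_of_mul_le_mul_left h2 (sub_pos.2 hxv))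

theorem IsMonotonePair.swap {ε : ℝ} (h : IsMonotonePair ε f g) : IsMonotonePair ε g f :=
  ⟨h.mem_g, h.mem_f, h.mono_g, h.mono_f⟩

/-- The potential treats `f` and `g` differently in form only; the swap lets the variation of `f`
yield the equation for `g` as well. -/
theorem IsMinimizer.swap (hw : IsWindow w) (hhf : IsUpdate hf) (hhg : IsUpdate hg)
    (ha : area hf hg 1 = 0) (hm : Integrable fun x : ℝ => |x| * w x) {ε : ℝ} (hε : 0 < ε)
    (h : IsMinimizer ε w hf hg f g) : IsMinimizer ε w hg hf g f := by
  refine ⟨h.1.swap, fun g' f' h' => ?_⟩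
  rw [← potential_swap hw hhf hhg ha hm (h.1.isIntegrableCDF_f hε) (h.1.isIntegrableCDF_g hε),
    ← potential_swap hw hhf hhg ha hm (h'.isIntegrableCDF_g hε) (h'.isIntegrableCDF_f hε)]
  exact h.2 f' g' h'.swap

theorem IsMinimizer.isWeakFixedPoint (hw : IsWindow w) (hhf : IsUpdate hf) (hhg : IsUpdate hg)
    (ha : area hf hg 1 = 0) (hm : Integrable fun x : ℝ => |x| * w x) {ε : ℝ} (hε : 0 < ε)
    (h : IsMinimizer ε w hf hg f g) : IsWeakFixedPoint w hf hg f g :=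
  ⟨fun _ hu => (h.swap hw hhf hhg ha hm hε).genInv_eq hw hhg hhf (area_one_swap hhf hhg ha) hm hε hu,
    fun _ hv => h.genInv_eq hw hhf hhg ha hm hε hv⟩

end Minimizer

end CoupledScalar

end

/-! ### Assembly of the claims. -/

theorem mainTheorem2 (w hf hg : ℝ → ℝ)
    (hw : CoupledScalar.IsWindow w) (hreg : CoupledScalar.IsRegular w)
    (hhf : CoupledScalar.IsUpdate hf) (hhg : CoupledScalar.IsUpdate hg)
    (hgap : CoupledScalar.StrictlyPositiveGap hf hg)
    (ε : ℝ) (hε : 0 < ε) :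
    -- any two non-decreasing fixed points are translates of each other
    (∀ (f₀ g₀ f₁ g₁ : ℝ → ℝ)
        (h₀ : CoupledScalar.IsMonotonePair ε f₀ g₀)
        (_h₁ : CoupledScalar.IsMonotonePair ε f₁ g₁),
        CoupledScalar.IsFixedPoint w hf hg f₀ g₀ →
        CoupledScalar.IsFixedPoint w hf hg f₁ g₁ →
        ∃ c : ℝ,
          (∀ᵐ y ∂(CoupledScalar.profileMeasure h₀.mono_f),
            y - CoupledScalar.transportMap f₀ f₁ y = -c) ∧
          (∀ᵐ x ∂(CoupledScalar.profileMeasure h₀.mono_g),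
            x - CoupledScalar.transportMap g₀ g₁ x = -c) ∧
          (∀ x, f₁ x = f₀ (x - c)) ∧ (∀ x, g₁ x = g₀ (x - c))) ∧
    (MeasureTheory.Integrable (fun x : ℝ => |x| * w x) →
      -- the potential is well defined
      (∀ f g : ℝ → ℝ, CoupledScalar.IsMonotonePair ε f g →
        MeasureTheory.Integrable (CoupledScalar.potentialDensity w hf hg f g)) ∧
      -- strict displacement convexity from a fixed point
      (∀ f₀ g₀ f₁ g₁ : ℝ → ℝ,
        CoupledScalar.IsMonotonePair ε f₀ g₀ → CoupledScalar.IsFixedPoint w hf hg f₀ g₀ →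
        CoupledScalar.IsMonotonePair ε f₁ g₁ →
        ((¬ ∃ c : ℝ, CoupledScalar.IsTranslateAE c g₀ g₁) ∨
          (CoupledScalar.StrictlyPositiveGapPhi hf hg ∧
            ¬ ∃ c : ℝ, CoupledScalar.IsTranslateAE c f₀ f₁ ∧
              CoupledScalar.IsTranslateAE c g₀ g₁)) →
        ∀ l ∈ Set.Ioo (0 : ℝ) 1,
          CoupledScalar.potential w hf hg
              (CoupledScalar.dispInterp l f₀ f₁) (CoupledScalar.dispInterp l g₀ g₁) <
            (1 - l) * CoupledScalar.potential w hf hg f₀ g₀ +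
              l * CoupledScalar.potential w hf hg f₁ g₁) ∧
      -- non-decreasing fixed points are minimizers
      (∀ f g : ℝ → ℝ, CoupledScalar.IsMonotonePair ε f g →
        CoupledScalar.IsFixedPoint w hf hg f g →
        CoupledScalar.IsMinimizer ε w hf hg f g) ∧
      -- uniqueness of minimizers up to translation
      (∀ f₀ g₀ f₁ g₁ : ℝ → ℝ,
        CoupledScalar.IsMinimizer ε w hf hg f₀ g₀ →
        CoupledScalar.IsMinimizer ε w hf hg f₁ g₁ →
        ∃ c : ℝ, CoupledScalar.IsTranslateAE c g₀ g₁ ∧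
          (CoupledScalar.StrictlyPositiveGapPhi hf hg →
            CoupledScalar.IsTranslateAE c f₀ f₁))) := by
  have ha := hgap.2
  refine ⟨fun f₀ g₀ f₁ g₁ h₀ h₁ hfix₀ hfix₁ => ?_, fun hm => ⟨fun f g h => ?_,
    fun f₀ g₀ f₁ g₁ h₀ hfix₀ h₁ hne l hl => ?_, fun f g h hfix => ⟨h, fun f' g' h' => ?_⟩,
    fun f₀ g₀ f₁ g₁ h₀ h₁ => ?_⟩⟩
  · obtain ⟨c, hcf, hcg⟩ := hfix₀.exists_translate hw hreg hhf hhg hgap hε h₀ h₁ hfix₁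
    exact ⟨c, CoupledScalar.ae_transportMap_eq (h₀.isCDF_f hε) hcf,
      CoupledScalar.ae_transportMap_eq (h₀.isCDF_g hε) hcg, hcf, hcg⟩
  · exact (CoupledScalar.integrable_and_integral_potentialDensity hw hhf hhg ha hm
      (h.isIntegrableCDF_f hε) (h.isIntegrableCDF_g hε)).1
  -- Failure of strictness gives equal window masses, and rigidity then makes the pair the translate
  -- that the hypothesis excludes.
  · by_contra hle
    obtain ⟨c, hcg, hcf⟩ := (hfix₀.isWeakFixedPoint hw hhf hhg (h₀.isCDF_f hε)
      (h₀.isCDF_g hε)).exists_displacement_of_ae hw hreg hhf hhg hgap (h₀.isCDF_f hε)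
      (h₀.isCDF_g hε) (h₁.isCDF_f hε) (h₁.isCDF_g hε)
      (CoupledScalar.ae_windowCDF_eq_of_potential_le hw hhf hhg ha hm (h₀.isIntegrableCDF_f hε)
        (h₀.isIntegrableCDF_g hε) (h₁.isIntegrableCDF_f hε) (h₁.isIntegrableCDF_g hε) hl
        (not_lt.mp hle))
    have hg' := CoupledScalar.isTranslateAE_of_quantile (h₀.isCDF_g hε) (h₁.isCDF_g hε) hcg
    rcases hne with hne | ⟨hPhi, hne⟩
    · exact hne ⟨c, hg'⟩
    · exact hne ⟨c, CoupledScalar.isTranslateAE_of_quantile (h₀.isCDF_f hε) (h₁.isCDF_f hε)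
        (hcf hPhi), hg'⟩
  · exact (hfix.isWeakFixedPoint hw hhf hhg (h.isCDF_f hε) (h.isCDF_g hε)).potential_le hw hhf hhg
      ha hm (h.isIntegrableCDF_f hε) (h.isIntegrableCDF_g hε) (h'.isIntegrableCDF_f hε)
      (h'.isIntegrableCDF_g hε)
  · obtain ⟨c, hcg, hcf⟩ :=
      (h₀.isWeakFixedPoint hw hhf hhg ha hm hε).exists_displacement_of_isWeakFixedPoint hw hreg
        hhf hhg hgap hε h₀.1 h₁.1 (h₁.isWeakFixedPoint hw hhf hhg ha hm hε)
    exact ⟨c, CoupledScalar.isTranslateAE_of_quantile (h₀.1.isCDF_g hε) (h₁.1.isCDF_g hε) hcg,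
      fun hPhi => CoupledScalar.isTranslateAE_of_quantile (h₀.1.isCDF_f hε) (h₁.1.isCDF_f hε)
        (hcf hPhi)⟩
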